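/- Let $S\in\{5/2,3,7/2,\dots\}$, let $\mathcal K=\{0,1,\dots,2S-4,2S\}$, let $N\ge 2$, and let $J_T>0$ for $T\in\mathcal K$. For $N$ spins $S$ put $$H=\sum_i\sum_{T\in\mathcal K}J_T\,P_T(i,i+1),$$ where $P_T(i,i+1)$ is the orthogonal projector onto the states in which the spins at sites $i,i+1$ have total spin $T$. The sum runs over $i\in\mathbb Z/N$ for the closed ring ($H_{\rm ring}$), and over the $N-1$ bonds of the chain for the open chain ($H_{\rm open}$). Let the spin-1 AKLT valence-bond state be built as follows. Each site carries a left and a right virtual spin $1/2$; the right virtual spin of site $i$ and the left virtual spin of site $i+1$ form a singlet; on each site the two virtual spins are projected onto spin $1$. On the ring all virtual spins are paired in this way. On the open chain the left virtual spin of the first site and the right virtual spin of the last site are in an arbitrary nonzero joint state $E\in\mathbb C^2\otimes\mathbb C^2$. Tensor the AKLT state with the fully polarized product state of $N$ spins $S-1$ (each with $S^z=S-1$), and project on every site $(S-1)\otimes 1\to S$. Call the result $\Psi_{\rm ring}$, respectively $\Psi_E$. Then: 1. $H_{\rm ring}\ge 0$, $\Psi_{\rm ring}\ne 0$ and $H_{\rm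 ring}\Psi_{\rm ring}=0$, so $\Psi_{\rm ring}$ is a zero-energy ground state; and $\langle\Psi_{\rm ring}|S^z_i|\Psi_{\rm ring}\rangle/\langle\Psi_{\rm ring}|\Psi_{\rm ring}\rangle=S-1$ for every site $i$. 2. Let $V$ be the space of two-site states obtained from $(0\oplus1)\otimes(2S-2)$, that is, from two spins $1$ with total spin $0$ or $1$ tensored with two spins $S-1$ with total spin $2S-2$, by projecting each site onto spin $S$. The reduced density matrix of $\Psi_{\rm ring}$ on any two neighbouring sites has its range in $V$; every vector of $V$ is a sum of vectors of total spin $2S-3$, $2S-2$, $2S-1$; and none of these three values lies in $\mathcal K$. 3. For every $E\neq 0$: $H_{\rm open}\ge0$, $\Psi_E\ne0$ and $H_{\rm open}\Psi_E=0$, and the reduced density matrix of $\Psi_E$ on any two neighbouring sites of the open chain has its range in $V$. -/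

import Mathlib

open scoped BigOperators ComplexConjugate

noncomputable section

namespace PartialFM

/-! ### Spin operators

A spin `k / 2` is the space `ℂ ^ (k + 1)`; the basis vector with index `a : Fin (k + 1)` is the
state `|j, m⟩` with `j = k / 2` and `m = k / 2 - a`, so index `0` is the fully polarized state. -/

/-- `S^z` of a single spin `k / 2`. -/
def spinZ (k : ℕ) : Matrix (Fin (k + 1)) (Fin (k + 1)) ℂ :=
  Matrix.diagonal fun a => (k : ℂ) / 2 - (a : ℕ)

/-- `S^+` of a single spin `k / 2`: `S^+ |j, m⟩ = √((j - m) (j + m + 1)) |j, m + 1⟩`. -/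
def spinPlus (k : ℕ) : Matrix (Fin (k + 1)) (Fin (k + 1)) ℂ :=
  Matrix.of fun a b =>
    if (b : ℕ) = a + 1 then ((Real.sqrt ((b : ℝ) * ((k : ℝ) + 1 - b)) : ℝ) : ℂ) else 0

/-- `S^-` of a single spin `k / 2`, the adjoint of `S^+`. -/
def spinMinus (k : ℕ) : Matrix (Fin (k + 1)) (Fin (k + 1)) ℂ :=
  (spinPlus k).conjTranspose

/-! ### Many spins -/

/-- The Hilbert space of spins `k / 2` sitting on the sites `ι`. -/
abbrev SpinSpace (k : ℕ) (ι : Type) [Fintype ι] := EuclideanSpace ℂ (ι → Fin (k + 1))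

section ManySpins

variable {ι : Type} [Fintype ι] [DecidableEq ι]

/-- The single-site operator `A` acting on site `i` (and as the identity elsewhere). -/
def siteOp {α : Type} [DecidableEq α] (A : Matrix α α ℂ) (i : ι) :
    Matrix (ι → α) (ι → α) ℂ :=
  Matrix.of fun x y => if ∀ j, j ≠ i → x j = y j then A (x i) (y i) else 0

/-- The Casimir operator `(∑_{i ∈ s} S_i)²` of the total spin of the sites in `s`, written as
`S^z S^z + (S^+ S^- + S^- S^+) / 2`. -/
def casimir (k : ℕ) (s : Finset ι) : Matrix (ι → Fin (k + 1)) (ι → Fin (k + 1)) ℂ :=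
  (∑ i ∈ s, siteOp (spinZ k) i) * (∑ i ∈ s, siteOp (spinZ k) i) +
    (1 / 2 : ℂ) •
      ((∑ i ∈ s, siteOp (spinPlus k) i) * (∑ i ∈ s, siteOp (spinMinus k) i) +
        (∑ i ∈ s, siteOp (spinMinus k) i) * (∑ i ∈ s, siteOp (spinPlus k) i))

/-- The states in which the spins in `s` have total spin `J`. -/
def spinSector (k : ℕ) (s : Finset ι) (J : ℝ) : Submodule ℂ (SpinSpace k ι) :=
  Module.End.eigenspace (Matrix.toEuclideanLin (casimir k s)) ((J * (J + 1) : ℝ) : ℂ)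

/-- The orthogonal projector onto the states in which the spins in `s` have total spin `J`. -/
def spinProjector (k : ℕ) (s : Finset ι) (J : ℝ) : SpinSpace k ι →L[ℂ] SpinSpace k ι :=
  (spinSector k s J).starProjection

/-- `W ⊗ W ⊗ ⋯ ⊗ W`: the linear map `W` applied on every site. -/
def siteMap {α β : Type} [Fintype α] [Fintype β] [DecidableEq β] (W : Matrix α β ℂ) :
    EuclideanSpace ℂ (ι → β) →ₗ[ℂ] EuclideanSpace ℂ (ι → α) :=
  Matrix.toEuclideanLin (Matrix.of fun x y => ∏ i, W (x i) (y i))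

/-- The tensor product of two many-body states on the same sites, regrouped so that the local
space on each site is the tensor product of the two local spaces. -/
def siteTensor {α β : Type} [Fintype α] [Fintype β]
    (a : EuclideanSpace ℂ (ι → α)) (b : EuclideanSpace ℂ (ι → β)) :
    EuclideanSpace ℂ (ι → α × β) :=
  WithLp.toLp 2 fun x => a (fun i => (x i).1) * b (fun i => (x i).2)

/-- The fully polarized product state of spins `k / 2`. -/
def polarized (k : ℕ) : SpinSpace k ι :=
  WithLp.toLp 2 fun x => if x = fun _ => 0 then 1 else 0

/-- The (unnormalized) reduced density matrix `Tr_env |ψ⟩⟨ψ|` of the sites `e 0, e 1, …`. -/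
def reducedDensity {α κ : Type} [Fintype α] [DecidableEq α] [Fintype κ]
    (ψ : EuclideanSpace ℂ (ι → α)) (e : κ → ι) : Matrix (κ → α) (κ → α) ℂ :=
  Matrix.of fun u v => ∑ x : ι → α, ∑ y : ι → α,
    if x ∘ e = u ∧ y ∘ e = v ∧ ∀ j, (∀ t, e t ≠ j) → x j = y j then ψ x * conj (ψ y) else 0

end ManySpins

/-- The normalized expectation value `⟨ψ|A|ψ⟩ / ⟨ψ|ψ⟩`. -/
def expectation {X : Type} [Fintype X] [DecidableEq X] (A : Matrix X X ℂ)
    (ψ : EuclideanSpace ℂ X) : ℂ :=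
  inner ℂ ψ (Matrix.toEuclideanLin A ψ) / inner ℂ ψ ψ

/-- `ψ` is a zero-energy ground state of `H`: a nonzero vector of energy `0`, where `H ≥ 0`. -/
def IsZeroEnergyGroundState {X : Type} [Fintype X]
    (H : EuclideanSpace ℂ X →L[ℂ] EuclideanSpace ℂ X) (ψ : EuclideanSpace ℂ X) : Prop :=
  H.IsPositive ∧ ψ ≠ 0 ∧ H ψ = 0

/-! ### The local projections `j₁ ⊗ j₂ → j₁ + j₂` -/

/-- The projection of `j₁ ⊗ j₂` onto its spin-`(j₁ + j₂)` component, for `j₁ = k₁ / 2`,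
`j₂ = k₂ / 2` and `k = k₁ + k₂`. Its entries are the Clebsch-Gordan coefficients
`⟨j₁ m₁; j₂ m₂ | j₁ + j₂, m₁ + m₂⟩ = √(C(k₁, a) C(k₂, b) / C(k, a + b))`,
where `a = j₁ - m₁` and `b = j₂ - m₂`. -/
def fuse (k₁ k₂ k : ℕ) : Matrix (Fin (k + 1)) (Fin (k₁ + 1) × Fin (k₂ + 1)) ℂ :=
  Matrix.of fun c p =>
    if (c : ℕ) = p.1 + p.2 then
      ((Real.sqrt ((k₁.choose p.1 * k₂.choose p.2 : ℝ) / k.choose c) : ℝ) : ℂ)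
    else 0

/-! ### The spin-1 AKLT valence-bond state -/

/-- The spin-1/2 singlet `(|↑↓⟩ - |↓↑⟩) / √2` as a matrix of coefficients. -/
def singlet : Matrix (Fin 2) (Fin 2) ℂ :=
  ((Real.sqrt 2 : ℝ) : ℂ)⁻¹ • !![0, 1; -1, 0]

/-- The valence-bond state of the virtual spins 1/2. Each of the `N` sites carries a left and a
right virtual spin 1/2. The right spin of site `i` and the left spin of site `i + 1` form a
singlet; the right spin of the last site and the left spin of the first one are in the state with
coefficients `E`. Thus `E = singlet` is the closed ring, and an arbitrary `E` is an open chain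
with free edge spins. -/
def valenceBonds (N : ℕ) [NeZero N] (E : Matrix (Fin 2) (Fin 2) ℂ) :
    EuclideanSpace ℂ (Fin N → Fin 2 × Fin 2) :=
  WithLp.toLp 2 fun x => ∏ i : Fin N,
    if (i : ℕ) + 1 < N then singlet (x i).2 (x (i + 1)).1 else E (x i).2 (x (i + 1)).1

/-- The spin-1 AKLT state: on every site the two virtual spins 1/2 are projected onto spin 1. -/
def aklt (N : ℕ) [NeZero N] (E : Matrix (Fin 2) (Fin 2) ℂ) : SpinSpace 2 (Fin N) :=
  siteMap (fuse 1 1 2) (valenceBonds N E)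

/-! ### The partially ferromagnetic state and the Hamiltonian, physical spin `S = n / 2` -/

/-- The partially ferromagnetic state: the spin-1 AKLT state tensored with the fully polarized
state of spins `S - 1`, projected on every site onto spin `S`. -/
def partialFerro (n N : ℕ) [NeZero N] (E : Matrix (Fin 2) (Fin 2) ℂ) : SpinSpace n (Fin N) :=
  siteMap (fuse 2 (n - 2) n) (siteTensor (aklt N E) (polarized (n - 2)))

/-- The set `K = {0, 1, …, 2S - 4, 2S}`. -/
def setK (n : ℕ) : Finset ℕ := insert n (Finset.range (n - 3))

/-- The bonds `(i, i + 1)` of the closed ring of `N` sites. -/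
def ringBonds (N : ℕ) : Finset (Fin N) := Finset.univ

/-- The bonds `(i, i + 1)` of the open chain of `N` sites. -/
def openBonds (N : ℕ) : Finset (Fin N) := Finset.univ.filter fun i => (i : ℕ) + 1 < N

/-- The Hamiltonian `∑_i ∑_{T ∈ K} J_T P_T(i, i + 1)`, the sum over `i` in the given bonds. -/
def hamiltonian (n N : ℕ) [NeZero N] (J : ℕ → ℝ) (bonds : Finset (Fin N)) :
    SpinSpace n (Fin N) →L[ℂ] SpinSpace n (Fin N) :=
  ∑ i ∈ bonds, ∑ T ∈ setK n, (J T : ℂ) • spinProjector n {i, i + 1} (T : ℝ)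

/-- The two-site states that arise from `(0 ⊕ 1) ⊗ (2S - 2)`: two spins 1 of total spin 0 or 1,
tensored with two spins `S - 1` of total spin `2S - 2`, each site projected onto spin `S`. -/
def pairSpace (n : ℕ) : Submodule ℂ (SpinSpace n (Fin 2)) :=
  Submodule.map (siteMap (fuse 2 (n - 2) n)) <|
    Submodule.span ℂ {v | ∃ a ∈ spinSector 2 (Finset.univ : Finset (Fin 2)) 0 ⊔
        spinSector 2 (Finset.univ : Finset (Fin 2)) 1,
      ∃ f ∈ spinSector (n - 2) (Finset.univ : Finset (Fin 2)) ((n : ℝ) - 2),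
        v = siteTensor a f}

end PartialFM

end

/-! Represent the basis state of index b of a spin k/2 by √C(k,b) X^b. States become polynomials of
degree at most k in each variable, the fusion j₁ ⊗ j₂ → j₁ + j₂ becomes multiplication, and the
polarized state becomes 1. Hence `partialFerro` and `aklt` have the same polynomial, a product over
the bonds, in which a singlet contributes a multiple of Xᵢ - Xᵢ₊₁. It is nonzero because polynomials
over ℂ have no zero divisors.

Put u = Xᵢ - Xⱼ and D_k = `pairDiff k`. The pair Casimir at level k is Cas_k = k(k+1) - u D_k, and
Cas_k(u p) = u Cas_{k-1}(p): the factor u is a singlet of two spins 1/2 and lowers the level by one.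
Across a singlet bond the state is u q, and since the AKLT polynomial has degree at most 2 in each
variable, q has degree at most 1 in Xᵢ and in Xⱼ. So q is a pair of spins 1/2, of total spin 0 or 1;
coupled to a background of total spin k - 2 it yields only k - 3, k - 2, k - 1. This is the cubic
identity `pairCasimir_cubic`, which `mem_iSup_spinSector` turns into a decomposition into sectors.
The other sectors are orthogonal to these because the Casimir is Hermitian, so every projector in H
kills the state.

The range of a reduced density matrix is spanned by slices, which are, up to normalization,
coefficients of the polynomial in the variables of the other sites. Divisibility by u and the degree
bound pass to slices, and by `mem_pairSpace` these two properties put a two-site state in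
`pairSpace`.

For the magnetization, the AKLT ring state is invariant up to sign under spin reversal and its
indices always sum to N. That sum rule makes the binomial weights introduced by the fusion reversal
invariant too, so the mean index at each site is 1. -/

namespace PartialFM

open MvPolynomial

/-! ### The two-site Casimir as a differential operator -/

section Polynomials

variable {σ : Type}

/-- `k (∂ᵢ - ∂ⱼ) + (Xᵢ - Xⱼ) ∂ᵢ ∂ⱼ`. In the polynomial picture the Casimir operator of two spins
`k / 2` is `k (k + 1) - (Xᵢ - Xⱼ)` times this operator. -/
noncomputable def pairDiff (k : ℂ) (i j : σ) (p : MvPolynomial σ ℂ) : MvPolynomial σ ℂ :=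
  C k * (pderiv i p - pderiv j p) + (X i - X j) * pderiv i (pderiv j p)

/-- The Casimir operator of two spins `k / 2` in the polynomial picture. -/
noncomputable def pairCasimir (k : ℂ) (i j : σ) (p : MvPolynomial σ ℂ) : MvPolynomial σ ℂ :=
  C (k * (k + 1)) * p - (X i - X j) * pairDiff k i j p

theorem pderiv_comm (i j : σ) (p : MvPolynomial σ ℂ) :
    pderiv i (pderiv j p) = pderiv j (pderiv i p) := by
  classical
  have h : ⁅(pderiv i : Derivation ℂ (MvPolynomial σ ℂ) (MvPolynomial σ ℂ)), pderiv j⁆ = (0 : Derivation ℂ (MvPolynomial σ ℂ) (MvPolynomial σ ℂ)) := by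
    apply MvPolynomial.derivation_ext
    intro l
    simp [Derivation.commutator_apply, pderiv_X, Pi.single_apply, apply_ite]
  have := congrArg (fun D => D p) h
  simpa [Derivation.commutator_apply, sub_eq_zero] using this

variable {i j : σ}

theorem pairDiff_add (k : ℂ) (p q : MvPolynomial σ ℂ) :
    pairDiff k i j (p + q) = pairDiff k i j p + pairDiff k i j q := by
  simp only [pairDiff, map_add]; ring

theorem pairDiff_C_mul (k c : ℂ) (p : MvPolynomial σ ℂ) :
    pairDiff k i j (C c * p) = C c * pairDiff k i j p := by
  simp only [pairDiff, pderiv_C_mul]; ring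

/-- The mixed derivative of u p contains -(∂ᵢ - ∂ⱼ) p, which is what shifts k to k - 1. -/
theorem pairDiff_sub_mul (hij : i ≠ j) (k : ℂ) (p : MvPolynomial σ ℂ) :
    pairDiff k i j ((X i - X j) * p) =
      C (2 * k) * p + (X i - X j) * pairDiff (k - 1) i j p := by
  simp only [pairDiff, pderiv_mul, map_add, map_sub, map_mul, pderiv_X_self, pderiv_one,
    pderiv_X_of_ne hij, pderiv_X_of_ne hij.symm, map_zero, map_ofNat, map_one]
  ring

theorem pairCasimir_sub_mul (hij : i ≠ j) (k : ℂ) (p : MvPolynomial σ ℂ) :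
    pairCasimir k i j ((X i - X j) * p) = (X i - X j) * pairCasimir (k - 1) i j p := by
  simp only [pairCasimir, pairDiff_sub_mul hij, map_mul, map_sub, map_add, map_ofNat, map_one]
  ring

/-- In spin terms q is a triplet and f has maximal total spin m, so both are symmetric under
exchange of i and j. The antisymmetric spin m is then absent from q f, leaving m + 1 and m - 1.
D_{m+1} removes the former, and the identity says that what remains has Casimir m(m+1) - 2m = (m-1)m
at level m. -/
theorem pairDiff_pairDiff_sym (hij : i ≠ j) {m : ℂ} {q f : MvPolynomial σ ℂ}
    (hqi : pderiv i (pderiv i q) = 0) (hqj : pderiv j (pderiv j q) = 0)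
    (hq : pairDiff 1 i j q = 0) (hf : pairDiff m i j f = 0) :
    (X i - X j) * pairDiff m i j (pairDiff (m + 1) i j (q * f)) =
      C (2 * m) * pairDiff (m + 1) i j (q * f) := by
  have hi := congrArg (pderiv i) hf
  have hj := congrArg (pderiv j) hf
  have hqji : pderiv i (pderiv i (pderiv j q)) = 0 := by
    rw [pderiv_comm i j, pderiv_comm i j, hqi, map_zero]
  have hg : pairDiff (m + 1) i j (q * f) = q * (pderiv i f - pderiv j f)
      + (C m + 1) * (pderiv i q - pderiv j q) * f
      + (X i - X j) * (pderiv i (pderiv j q) * f + pderiv i q * pderiv j f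
        + pderiv j q * pderiv i f) := by
    have h0 := hf
    simp only [pairDiff, pderiv_mul, map_add, map_one] at h0 ⊢
    linear_combination q * h0
  rw [hg]
  simp only [pairDiff, pderiv_mul, map_add, map_sub, map_mul, pderiv_X_self, pderiv_one, pderiv_C,
    pderiv_X_of_ne hij, pderiv_X_of_ne hij.symm, map_zero, pderiv_comm j i, map_ofNat, map_one,
    hqji, hqi, hqj] at hi hj hq hf ⊢
  linear_combination (X i - X j) * q * (hi - hj)
    + (X i - X j) ^ 2 * (pderiv i q * hj + pderiv j q * hi)
    + ((X i - X j) * (C m + 2) * (pderiv i q - pderiv j q)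
      + 3 * (X i - X j) ^ 2 * pderiv i (pderiv j q) - 2 * q) * hf
    - 2 * C m * (C m + 1) * f * hq

theorem pairDiff_cubic_sym (hij : i ≠ j) {m : ℂ} {q f : MvPolynomial σ ℂ}
    (hqi : pderiv i (pderiv i q) = 0) (hqj : pderiv j (pderiv j q) = 0)
    (hq : pairDiff 1 i j q = 0) (hf : pairDiff m i j f = 0) :
    pairDiff (m - 1) i j (pairDiff m i j (pairDiff (m + 1) i j (q * f))) = 0 := by
  have h := pairDiff_pairDiff_sym hij hqi hqj hq hf
  have h' := congrArg (pairDiff m i j) h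
  rw [pairDiff_sub_mul hij, pairDiff_C_mul] at h'
  have hu : (X i - X j : MvPolynomial σ ℂ) ≠ 0 := sub_ne_zero.2 fun h => hij (X_injective h)
  exact (mul_eq_zero.1 (by linear_combination h')).resolve_left hu

/-- Split q = s + u r into triplet and singlet, with r = D_1 q / 2 free of Xᵢ and Xⱼ. The triplet
part is the symmetric case; for the singlet part D_{m+1}(u f) = 2(m+1) f, which D_m annihilates. -/
theorem pairDiff_cubic (hij : i ≠ j) {m : ℂ} {q f : MvPolynomial σ ℂ}
    (hqi : pderiv i (pderiv i q) = 0) (hqj : pderiv j (pderiv j q) = 0)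
    (hf : pairDiff m i j f = 0) :
    pairDiff (m - 1) i j (pairDiff m i j (pairDiff (m + 1) i j (q * f))) = 0 := by
  have hqji : pderiv i (pderiv i (pderiv j q)) = 0 := by
    rw [pderiv_comm i j, pderiv_comm i j, hqi, map_zero]
  set r := C (1 / 2) * pairDiff 1 i j q with hr
  have h2 : (C (1 / 2) : MvPolynomial σ ℂ) * 2 = 1 := by
    rw [← map_ofNat C 2, ← map_mul]; norm_num
  have hri : pderiv i r = 0 := by
    simp only [hr, pairDiff, pderiv_mul, map_add, map_sub, pderiv_X_self, pderiv_one,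
      pderiv_C, pderiv_X_of_ne hij.symm, map_one, hqji, hqi]
    ring
  have hrj : pderiv j r = 0 := by
    simp only [hr, pairDiff, pderiv_mul, map_add, map_sub, pderiv_X_self, pderiv_one,
      pderiv_C, pderiv_X_of_ne hij, map_zero, pderiv_comm j i, map_one, hqj]
    ring
  have hL : ∀ k p, pairDiff k i j (r * p) = r * pairDiff k i j p := fun k p => by
    simp only [pairDiff, pderiv_mul, hri, hrj, zero_mul, zero_add]
    ring
  set s := q - (X i - X j) * r with hs
  have hsi : pderiv i (pderiv i s) = 0 := by
    simp [hs, hqi, hri, pderiv_X_of_ne hij.symm]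
  have hsj : pderiv j (pderiv j s) = 0 := by
    simp [hs, hqj, hrj, pderiv_X_of_ne hij]
  have hs1 : pairDiff 1 i j s = 0 := by
    have h1 : pairDiff 1 i j q = 2 * r := by rw [hr]; linear_combination -pairDiff 1 i j q * h2
    have : s = q + C (-1) * ((X i - X j) * r) := by simp [hs]; ring
    rw [this, pairDiff_add, pairDiff_C_mul, pairDiff_sub_mul hij, h1]
    simp only [pairDiff, hri, hrj, map_zero, map_neg, map_one, mul_one, map_ofNat]
    ring
  have hqs : q * f = s * f + r * ((X i - X j) * f) := by rw [hs]; ring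
  rw [hqs, pairDiff_add, pairDiff_add, pairDiff_add, pairDiff_cubic_sym hij hsi hsj hs1 hf]
  have h0 : ∀ k, pairDiff k i j (0 : MvPolynomial σ ℂ) = 0 := fun k => by simp [pairDiff]
  rw [hL, hL, hL, pairDiff_sub_mul hij, add_sub_cancel_right, hf, mul_zero, add_zero,
    pairDiff_C_mul, hf, mul_zero, h0, mul_zero, add_zero]

/-- The annihilating polynomial of the Casimir operator on `(Xᵢ - Xⱼ) q f`, where `q` has degree at
most one in `Xᵢ` and in `Xⱼ`, and `f` has maximal total spin `k - 2`. -/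
theorem pairCasimir_cubic (hij : i ≠ j) {k : ℂ} {q f : MvPolynomial σ ℂ}
    (hqi : pderiv i (pderiv i q) = 0) (hqj : pderiv j (pderiv j q) = 0)
    (hf : pairDiff (k - 2) i j f = 0) {p₁ p₂ p₃ : MvPolynomial σ ℂ}
    (h₁ : p₁ = pairCasimir k i j ((X i - X j) * (q * f)) -
      C ((k - 1) * k) * ((X i - X j) * (q * f)))
    (h₂ : p₂ = pairCasimir k i j p₁ - C ((k - 2) * (k - 1)) * p₁)
    (h₃ : p₃ = pairCasimir k i j p₂ - C ((k - 3) * (k - 2)) * p₂) : p₃ = 0 := by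
  -- Subtracting the top eigenvalue leaves -u D_k. Each of the three factors thus extracts one more
  -- u, and the next Casimir acts one level lower.
  have key : ∀ k c p, c = k * (k + 1) → pairCasimir k i j p - C c * p =
      (X i - X j) * (C (-1) * pairDiff k i j p) := fun k c p hc => by
    rw [hc]; simp only [pairCasimir, map_neg, map_one]; ring
  have e₁ : p₁ = (X i - X j) * ((X i - X j) * (C (-1) * pairDiff (k - 1) i j (q * f))) := by
    rw [h₁, pairCasimir_sub_mul hij]
    linear_combination (X i - X j) * key (k - 1) ((k - 1) * k) (q * f) (by ring)
  have e₂ : p₂ = (X i - X j) * ((X i - X j) * ((X i - X j) *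
      (C (-1) * pairDiff (k - 1 - 1) i j (C (-1) * pairDiff (k - 1) i j (q * f))))) := by
    rw [h₂, e₁, pairCasimir_sub_mul hij, pairCasimir_sub_mul hij]
    linear_combination (X i - X j) ^ 2 * key (k - 1 - 1) ((k - 2) * (k - 1)) _ (by ring)
  have e₃ : p₃ = (X i - X j) * ((X i - X j) * ((X i - X j) * ((X i - X j) *
      (C (-1) * pairDiff (k - 1 - 1 - 1) i j
        (C (-1) * pairDiff (k - 1 - 1) i j (C (-1) * pairDiff (k - 1) i j (q * f))))))) := by
    rw [h₃, e₂, pairCasimir_sub_mul hij, pairCasimir_sub_mul hij, pairCasimir_sub_mul hij]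
    linear_combination (X i - X j) ^ 3 * key (k - 1 - 1 - 1) ((k - 3) * (k - 2)) _ (by ring)
  have h := pairDiff_cubic hij hqi hqj hf
  rw [show k - 2 + 1 = k - 1 by ring, show k - 2 - 1 = k - 1 - 1 - 1 by ring,
    show k - 2 = k - 1 - 1 by ring] at h
  rw [e₃]
  simp only [pairDiff_C_mul, h, mul_zero]

theorem pairDiff_pairDiff_zero (hij : i ≠ j) {q : MvPolynomial σ ℂ}
    (hqi : pderiv i (pderiv i q) = 0) (hqj : pderiv j (pderiv j q) = 0) :
    pairDiff 0 i j (pairDiff 1 i j q) = 0 := by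
  have hqji : pderiv i (pderiv i (pderiv j q)) = 0 := by
    rw [pderiv_comm i j, pderiv_comm i j, hqi, map_zero]
  simp [pairDiff, pderiv_X_of_ne hij, pderiv_X_of_ne hij.symm, pderiv_comm j i,
    hqji, hqi, hqj]

/-- Two spins 1 in the state `(Xᵢ - Xⱼ) q` have total spin 0 or 1. -/
theorem pairCasimir_quadratic (hij : i ≠ j) {q p : MvPolynomial σ ℂ}
    (hqi : pderiv i (pderiv i q) = 0) (hqj : pderiv j (pderiv j q) = 0)
    (hp : p = pairCasimir 2 i j ((X i - X j) * q) - C 2 * ((X i - X j) * q)) :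
    pairCasimir 2 i j p = 0 := by
  have e : p = (X i - X j) * ((X i - X j) * (C (-1) * pairDiff 1 i j q)) := by
    rw [hp, pairCasimir_sub_mul hij, pairCasimir, show (2 : ℂ) - 1 = 1 by norm_num,
      show (1 : ℂ) * (1 + 1) = 2 by norm_num, map_neg, map_one]
    ring
  rw [e, pairCasimir_sub_mul hij, pairCasimir_sub_mul hij, show (2 : ℂ) - 1 - 1 = 0 by norm_num,
    pairCasimir, pairDiff_C_mul, pairDiff_pairDiff_zero hij hqi hqj]
  simp

theorem degreeOf_eq_zero_iff_notMem_vars {i : σ} {p : MvPolynomial σ ℂ} :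
    p.degreeOf i = 0 ↔ i ∉ p.vars := by
  classical
  rw [degreeOf_def, vars_def, Multiset.mem_toFinset, Multiset.count_eq_zero]

theorem degreeOf_pderiv_le {i : σ} {p : MvPolynomial σ ℂ} {d : ℕ} (h : p.degreeOf i ≤ d + 1) :
    (pderiv i p).degreeOf i ≤ d := by
  classical
  rw [degreeOf_le_iff] at h ⊢
  intro m hm
  have := h (m + Finsupp.single i 1) (by
    rw [mem_support_iff, coeff_pderiv] at hm
    exact mem_support_iff.2 (left_ne_zero_of_mul hm))
  simpa using this

theorem pderiv_pderiv_eq_zero {i : σ} {p : MvPolynomial σ ℂ} (h : p.degreeOf i ≤ 1) :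
    pderiv i (pderiv i p) = 0 := by
  classical
  have h0 : (pderiv i p).degreeOf i = 0 := Nat.le_zero.1 (degreeOf_pderiv_le h)
  exact pderiv_eq_zero_of_notMem_vars (degreeOf_eq_zero_iff_notMem_vars.1 h0)

/-- Degrees in one variable add over a domain, and u already uses one degree in Xᵢ and one in Xⱼ. -/
theorem pderiv_pderiv_eq_zero_of_sub_mul (hij : i ≠ j) {q : MvPolynomial σ ℂ}
    (h : ∀ l, ((X i - X j) * q).degreeOf l ≤ 2) :
    pderiv i (pderiv i q) = 0 ∧ pderiv j (pderiv j q) = 0 := by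
  classical
  rcases eq_or_ne q 0 with rfl | hq
  · simp
  have hu : (X i - X j : MvPolynomial σ ℂ) ≠ 0 := sub_ne_zero.2 fun h => hij (X_injective h)
  have hd : ∀ l, (l = i ∨ l = j) → 1 ≤ (X i - X j : MvPolynomial σ ℂ).degreeOf l := by
    intro l hl
    by_contra hlt
    have h0 : l ∉ (X i - X j : MvPolynomial σ ℂ).vars := by
      rw [← degreeOf_eq_zero_iff_notMem_vars]; omega
    have := pderiv_eq_zero_of_notMem_vars h0
    rcases hl with rfl | rfl
    · simp [pderiv_X_of_ne hij.symm] at this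
    · simp [pderiv_X_of_ne hij] at this
  constructor <;> apply pderiv_pderiv_eq_zero
  · have := h i
    rw [degreeOf_mul_eq hu hq] at this
    have := hd i (.inl rfl)
    omega
  · have := h j
    rw [degreeOf_mul_eq hu hq] at this
    have := hd j (.inr rfl)
    omega

end Polynomials

/-! ### Spin states as polynomials and spin operators as differential operators -/

section Representation

variable {ι : Type} [Fintype ι] [DecidableEq ι]

/-- The square root of a binomial coefficient: the basis state with index `b` of a spin `k / 2` is
the polynomial `√(C(k, b)) X ^ b`. -/
noncomputable def sqrtChoose (k b : ℕ) : ℂ := ((Real.sqrt (k.choose b) : ℝ) : ℂ)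

theorem sqrtChoose_ne_zero {k b : ℕ} (h : b ≤ k) : sqrtChoose k b ≠ 0 := by
  have : (0 : ℝ) < k.choose b := by exact_mod_cast Nat.choose_pos h
  simpa [sqrtChoose] using (Real.sqrt_pos.2 this).ne'

/-- The polynomial of a product basis state. -/
noncomputable def basisPoly (k : ℕ) (x : ι → Fin (k + 1)) : MvPolynomial ι ℂ :=
  ∏ i, (C (sqrtChoose k (x i)) * X i ^ (x i : ℕ))

/-- The exponents of the polynomial of a product basis state. -/
noncomputable def exponents {k : ℕ} (x : ι → Fin (k + 1)) : ι →₀ ℕ :=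
  Finsupp.equivFunOnFinite.symm fun i => (x i : ℕ)

theorem exponents_injective {k : ℕ} : Function.Injective (exponents (ι := ι) (k := k)) := by
  intro x y h
  funext i
  exact Fin.ext (DFunLike.congr_fun h i)

theorem prod_X_pow_eq_monomial (m : ι →₀ ℕ) :
    ∏ i, (X i : MvPolynomial ι ℂ) ^ m i = monomial m 1 := by
  rw [monomial_eq, map_one, one_mul, Finsupp.prod_fintype _ _ (fun _ => pow_zero _)]

theorem basisPoly_eq_monomial (k : ℕ) (x : ι → Fin (k + 1)) :
    basisPoly k x = monomial (exponents x) (∏ i, sqrtChoose k (x i)) := by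
  rw [basisPoly, Finset.prod_mul_distrib, ← map_prod, ← mul_one (∏ i, sqrtChoose k (x i)),
    ← C_mul_monomial, mul_one, ← prod_X_pow_eq_monomial]
  rfl

/-- Many-body states of spins `k / 2` as polynomials of degree at most `k` in each variable. -/
noncomputable def toPoly (k : ℕ) : SpinSpace k ι →ₗ[ℂ] MvPolynomial ι ℂ where
  toFun ψ := ∑ x, C (ψ x) * basisPoly k x
  map_add' ψ φ := by simp [add_mul, Finset.sum_add_distrib]
  map_smul' c ψ := by simp [smul_eq_C_mul, Finset.mul_sum, mul_assoc]

theorem toPoly_apply (k : ℕ) (ψ : SpinSpace k ι) :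
    toPoly k ψ = ∑ x, C (ψ x) * basisPoly k x := rfl

theorem coeff_toPoly (k : ℕ) (ψ : SpinSpace k ι) (x : ι → Fin (k + 1)) :
    coeff (exponents x) (toPoly k ψ) = ψ x * ∏ i, sqrtChoose k (x i) := by
  rw [toPoly_apply, coeff_sum, Finset.sum_eq_single x]
  · rw [basisPoly_eq_monomial, coeff_C_mul, coeff_monomial, if_pos rfl]
  · intro y _ hy
    rw [basisPoly_eq_monomial, coeff_C_mul, coeff_monomial,
      if_neg fun h => hy (exponents_injective h), mul_zero]
  · simp

theorem prod_sqrtChoose_ne_zero {k : ℕ} (x : ι → Fin (k + 1)) :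
    ∏ i, sqrtChoose k (x i) ≠ 0 :=
  Finset.prod_ne_zero_iff.2 fun i _ => sqrtChoose_ne_zero (Nat.lt_succ_iff.1 (x i).2)

theorem toPoly_injective (k : ℕ) : Function.Injective (toPoly (ι := ι) k) := by
  intro ψ φ h
  ext x
  have := congrArg (coeff (exponents x)) h
  rw [coeff_toPoly, coeff_toPoly] at this
  exact mul_right_cancel₀ (prod_sqrtChoose_ne_zero x) this

theorem degreeOf_toPoly_le (k : ℕ) (ψ : SpinSpace k ι) (i : ι) :
    (toPoly k ψ).degreeOf i ≤ k := by
  rw [toPoly_apply]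
  refine (degreeOf_sum_le _ _ _).trans (Finset.sup_le fun x _ => ?_)
  rw [basisPoly_eq_monomial, C_mul_monomial]
  refine (degreeOf_le_iff).2 fun m hm => ?_
  rw [Finset.mem_singleton.1 (support_monomial_subset hm)]
  exact Nat.lt_succ_iff.1 (x i).2

theorem exists_toPoly_eq {k : ℕ} {p : MvPolynomial ι ℂ} (h : ∀ i, p.degreeOf i ≤ k) :
    ∃ ψ, toPoly k ψ = p := by
  refine ⟨WithLp.toLp 2 fun x => coeff (exponents x) p / ∏ i, sqrtChoose k (x i), ?_⟩
  ext m
  by_cases hm : ∀ i, m i ≤ k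
  · obtain ⟨x, rfl⟩ : ∃ x : ι → Fin (k + 1), exponents x = m :=
      ⟨fun i => ⟨m i, Nat.lt_succ_iff.2 (hm i)⟩, by ext i; rfl⟩
    rw [coeff_toPoly]
    exact div_mul_cancel₀ _ (prod_sqrtChoose_ne_zero x)
  · have h0 : ∀ q : MvPolynomial ι ℂ, (∀ i, q.degreeOf i ≤ k) → coeff m q = 0 := fun q hq => by
      by_contra hne
      exact hm fun i => degreeOf_le_iff.1 (hq i) m (mem_support_iff.2 hne)
    rw [h0 p h, h0 _ (degreeOf_toPoly_le k _)]

/-- The operator `A` becomes `T` in the polynomial picture. -/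
def Intertwines (k : ℕ) (A : Matrix (ι → Fin (k + 1)) (ι → Fin (k + 1)) ℂ)
    (T : Module.End ℂ (MvPolynomial ι ℂ)) : Prop :=
  ∀ ψ : SpinSpace k ι, toPoly k (Matrix.toEuclideanLin A ψ) = T (toPoly k ψ)

namespace Intertwines

variable {k : ℕ} {A B : Matrix (ι → Fin (k + 1)) (ι → Fin (k + 1)) ℂ}
  {T U : Module.End ℂ (MvPolynomial ι ℂ)}

theorem add (hA : Intertwines k A T) (hB : Intertwines k B U) : Intertwines k (A + B) (T + U) :=
  fun ψ => by rw [map_add, LinearMap.add_apply, map_add, hA, hB, LinearMap.add_apply]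

theorem smul (c : ℂ) (hA : Intertwines k A T) : Intertwines k (c • A) (c • T) :=
  fun ψ => by rw [map_smul, LinearMap.smul_apply, map_smul, hA, LinearMap.smul_apply]

theorem mul (hA : Intertwines k A T) (hB : Intertwines k B U) : Intertwines k (A * B) (T * U) :=
  fun ψ => by
    rw [Matrix.toEuclideanLin, Matrix.toLpLin_mul_same, LinearMap.comp_apply, hA, hB]
    rfl

theorem sum {s : Finset ι} {A : ι → Matrix (ι → Fin (k + 1)) (ι → Fin (k + 1)) ℂ}
    {T : ι → Module.End ℂ (MvPolynomial ι ℂ)} (h : ∀ i, Intertwines k (A i) (T i)) :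
    Intertwines k (∑ i ∈ s, A i) (∑ i ∈ s, T i) := fun ψ => by
  simp only [map_sum, LinearMap.sum_apply]
  exact Finset.sum_congr rfl fun i _ => h i ψ

end Intertwines

theorem basisPoly_eq_mul (k : ℕ) (x : ι → Fin (k + 1)) (i : ι) (a : Fin (k + 1)) :
    basisPoly k (Function.update x i a) = (C (sqrtChoose k a) * X i ^ (a : ℕ)) *
      ∏ j ∈ Finset.univ.erase i, (C (sqrtChoose k (x j)) * X j ^ (x j : ℕ)) := by
  rw [basisPoly, ← Finset.mul_prod_erase _ _ (Finset.mem_univ i), Function.update_self]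
  congr 1
  refine Finset.prod_congr rfl fun j hj => ?_
  rw [Function.update_of_ne (Finset.ne_of_mem_erase hj)]

/-- A single-site operator is a differential operator in the variable of that site. -/
theorem intertwines_siteOp {k : ℕ} {A : Matrix (Fin (k + 1)) (Fin (k + 1)) ℂ} {i : ι}
    {T : Module.End ℂ (MvPolynomial ι ℂ)}
    (hT : ∀ p r, pderiv i r = 0 → T (p * r) = T p * r)
    (hA : ∀ b : Fin (k + 1), T (C (sqrtChoose k b) * X i ^ (b : ℕ)) =
      ∑ a, C (A a b) * (C (sqrtChoose k a) * X i ^ (a : ℕ))) :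
    Intertwines k (siteOp A i) T := by
  intro ψ
  have hrest : ∀ x : ι → Fin (k + 1), pderiv i (∏ j ∈ Finset.univ.erase i,
      (C (sqrtChoose k (x j)) * X j ^ (x j : ℕ)) : MvPolynomial ι ℂ) = 0 := by
    intro x
    refine Finset.prod_induction _ (fun p => pderiv i p = 0) (fun p q hp hq => ?_) (by simp)
      fun j hj => ?_
    · rw [pderiv_mul, hp, hq, zero_mul, mul_zero, add_zero]
    · rw [pderiv_C_mul, pderiv_pow, pderiv_X_of_ne (Finset.ne_of_mem_erase hj), mul_zero, mul_zero]
  have hb : ∀ y : ι → Fin (k + 1), T (basisPoly k y) =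
      ∑ x, C (siteOp A i x y) * basisPoly k x := by
    intro y
    have h1 := basisPoly_eq_mul k y i (y i)
    rw [Function.update_eq_self] at h1
    rw [h1, hT _ _ (hrest y), hA, Finset.sum_mul]
    refine Fintype.sum_of_injective (fun a => Function.update y i a)
      (Function.update_injective y i) _ _ ?_ ?_
    · intro x hx
      have : siteOp A i x y = 0 := by
        rw [siteOp, Matrix.of_apply, if_neg]
        intro h
        refine hx ⟨x i, funext fun j => ?_⟩
        rcases eq_or_ne j i with rfl | hj
        · simp
        · simp [hj, h j hj]
      rw [this, map_zero, zero_mul]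
    · intro a
      have : siteOp A i (Function.update y i a) y = A a (y i) := by
        rw [siteOp, Matrix.of_apply, if_pos fun j hj => Function.update_of_ne hj _ _,
          Function.update_self]
      rw [this, basisPoly_eq_mul, mul_assoc]
  simp only [toPoly_apply, map_sum, ← smul_eq_C_mul, map_smul] at hb ⊢
  simp only [hb, Matrix.toLpLin_apply, Matrix.mulVec, dotProduct, Finset.smul_sum, smul_smul,
    Finset.sum_smul]
  rw [Finset.sum_comm]
  refine Finset.sum_congr rfl fun y _ => Finset.sum_congr rfl fun x _ => ?_
  rw [mul_comm]

/-- `S^z` in the polynomial picture. -/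
noncomputable def polyZ (k : ℕ) (i : ι) : Module.End ℂ (MvPolynomial ι ℂ) :=
  ((k : ℂ) / 2) • 1 - LinearMap.mulLeft ℂ (X i) * (pderiv i).toLinearMap

/-- `S^+` in the polynomial picture. -/
noncomputable def polyPlus (i : ι) : Module.End ℂ (MvPolynomial ι ℂ) := (pderiv i).toLinearMap

/-- `S^-` in the polynomial picture. -/
noncomputable def polyMinus (k : ℕ) (i : ι) : Module.End ℂ (MvPolynomial ι ℂ) :=
  (k : ℂ) • LinearMap.mulLeft ℂ (X i) - LinearMap.mulLeft ℂ (X i ^ 2) * (pderiv i).toLinearMap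

theorem X_mul_pderiv_basis (k : ℕ) (i : ι) (b : ℕ) :
    (X i : MvPolynomial ι ℂ) * pderiv i (C (sqrtChoose k b) * X i ^ b) =
      (b : MvPolynomial ι ℂ) * (C (sqrtChoose k b) * X i ^ b) := by
  rw [pderiv_C_mul, pderiv_pow, pderiv_X_self]
  rcases b with _ | b
  · simp
  · rw [Nat.add_sub_cancel, pow_succ]; ring

theorem intertwines_spinZ (k : ℕ) (i : ι) :
    Intertwines k (siteOp (spinZ k) i) (polyZ k i) := by
  refine intertwines_siteOp (fun p r hr => ?_) fun b => ?_
  · simp [polyZ, hr, smul_eq_C_mul]; ring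
  · rw [Finset.sum_eq_single b]
    · simp only [polyZ, spinZ, Matrix.diagonal_apply_eq, LinearMap.sub_apply, LinearMap.smul_apply,
        Module.End.one_apply, Module.End.mul_apply, LinearMap.mulLeft_apply,
        Derivation.coeFn_coe, X_mul_pderiv_basis, smul_eq_C_mul,
        map_sub, map_natCast]
      ring
    · intro a _ hab
      simp [spinZ, Matrix.diagonal_apply_ne _ hab]
    · simp

/-- `√(b (k + 1 - b)) √(C(k, b - 1)) = b √(C(k, b))`. -/
theorem sqrt_mul_sqrtChoose {k a : ℕ} (h : a + 1 ≤ k) :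
    ((Real.sqrt (((a + 1 : ℕ) : ℝ) * ((k : ℝ) + 1 - ((a + 1 : ℕ) : ℝ))) : ℝ) : ℂ) * sqrtChoose k a =
      ((a + 1 : ℕ) : ℂ) * sqrtChoose k (a + 1) := by
  have h1 : (k.choose (a + 1) : ℝ) * ((a + 1 : ℕ) : ℝ) = k.choose a * ((k : ℝ) - a) := by
    have := Nat.choose_succ_right_eq k a
    rw [← Nat.cast_sub (by omega : a ≤ k)]
    exact_mod_cast this
  have hk : (0 : ℝ) ≤ (k : ℝ) + 1 - ((a + 1 : ℕ) : ℝ) := by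
    have : ((a + 1 : ℕ) : ℝ) ≤ k := by exact_mod_cast h
    linarith
  have key : Real.sqrt (((a + 1 : ℕ) : ℝ) * ((k : ℝ) + 1 - ((a + 1 : ℕ) : ℝ))) *
      Real.sqrt (k.choose a) = ((a + 1 : ℕ) : ℝ) * Real.sqrt (k.choose (a + 1)) := by
    rw [← Real.sqrt_mul (by positivity), ← Real.sqrt_sq (Nat.cast_nonneg (a + 1) : (0 : ℝ) ≤ _),
      ← Real.sqrt_mul (sq_nonneg _), Real.sqrt_sq (Nat.cast_nonneg (a + 1))]
    congr 1
    push_cast at h1 ⊢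
    linear_combination -((a : ℝ) + 1) * h1
  rw [sqrtChoose, sqrtChoose]
  exact_mod_cast key

/-- `√((a + 1) (k - a)) √(C(k, a + 1)) = (k - a) √(C(k, a))`. -/
theorem sqrt_mul_sqrtChoose_succ {k a : ℕ} (h : a + 1 ≤ k) :
    ((Real.sqrt (((a + 1 : ℕ) : ℝ) * ((k : ℝ) + 1 - ((a + 1 : ℕ) : ℝ))) : ℝ) : ℂ) *
      sqrtChoose k (a + 1) = ((k : ℂ) - a) * sqrtChoose k a := by
  have h1 : (k.choose (a + 1) : ℝ) * ((a + 1 : ℕ) : ℝ) = k.choose a * ((k : ℝ) - a) := by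
    have := Nat.choose_succ_right_eq k a
    rw [← Nat.cast_sub (by omega : a ≤ k)]
    exact_mod_cast this
  have hk : (0 : ℝ) ≤ (k : ℝ) - a := by
    have : ((a + 1 : ℕ) : ℝ) ≤ k := by exact_mod_cast h
    push_cast at this
    linarith
  have key : Real.sqrt (((a + 1 : ℕ) : ℝ) * ((k : ℝ) + 1 - ((a + 1 : ℕ) : ℝ))) *
      Real.sqrt (k.choose (a + 1)) = ((k : ℝ) - a) * Real.sqrt (k.choose a) := by
    have e : (k : ℝ) + 1 - ((a + 1 : ℕ) : ℝ) = k - a := by push_cast; ring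
    rw [e, ← Real.sqrt_mul (by positivity), ← Real.sqrt_sq hk, ← Real.sqrt_mul (sq_nonneg _),
      Real.sqrt_sq hk]
    congr 1
    push_cast at h1 ⊢
    linear_combination ((k : ℝ) - a) * h1
  rw [sqrtChoose, sqrtChoose]
  exact_mod_cast key

theorem intertwines_spinPlus (k : ℕ) (i : ι) :
    Intertwines k (siteOp (spinPlus k) i) (polyPlus i) := by
  refine intertwines_siteOp (fun p r hr => ?_) fun b => ?_
  · simp [polyPlus, hr, mul_comm]
  · obtain ⟨b, hb⟩ := b
    rcases b with _ | b
    · simp [polyPlus, spinPlus]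
    · rw [Finset.sum_eq_single ⟨b, by omega⟩]
      · have h := sqrt_mul_sqrtChoose (k := k) (a := b) (by omega)
        simp only [polyPlus, spinPlus, Matrix.of_apply, if_true, ← mul_assoc, ← map_mul, h]
        simp
        ring
      · intro a _ hab
        have : ¬ (b + 1 = (a : ℕ) + 1) := fun h => hab (Fin.ext (by simpa using h.symm))
        simp only [spinPlus, Matrix.of_apply, if_neg this, map_zero, zero_mul]
      · simp

theorem intertwines_spinMinus (k : ℕ) (i : ι) :
    Intertwines k (siteOp (spinMinus k) i) (polyMinus k i) := by
  refine intertwines_siteOp (fun p r hr => ?_) fun b => ?_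
  · simp [polyMinus, hr, smul_eq_C_mul]; ring
  · have hL : polyMinus k i (C (sqrtChoose k b) * X i ^ (b : ℕ)) =
        C ((k : ℂ) - (b : ℕ)) * C (sqrtChoose k b) * X i ^ ((b : ℕ) + 1) := by
      have h := X_mul_pderiv_basis k i b
      simp only [polyMinus, LinearMap.sub_apply, LinearMap.smul_apply, Module.End.mul_apply,
        LinearMap.mulLeft_apply, Derivation.coeFn_coe,
        smul_eq_C_mul, map_sub, map_natCast, pow_succ]
      linear_combination -X i * h
    rw [hL]
    obtain ⟨b, hb⟩ := b
    rcases (Nat.lt_succ_iff.1 hb).eq_or_lt with rfl | hlt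
    · symm
      simp only [sub_self, map_zero, zero_mul]
      refine Finset.sum_eq_zero fun a _ => ?_
      have : ¬ ((a : ℕ) = b + 1) := by have := a.2; omega
      simp only [spinMinus, spinPlus, Matrix.conjTranspose_apply, Matrix.of_apply, if_neg this,
        star_zero, map_zero, zero_mul]
    · rw [Finset.sum_eq_single ⟨b + 1, by omega⟩]
      · have h := sqrt_mul_sqrtChoose_succ (k := k) (a := b) (by omega)
        simp only [spinMinus, spinPlus, Matrix.conjTranspose_apply, Matrix.of_apply, if_true,
          ← mul_assoc, ← map_mul, RCLike.star_def, Complex.conj_ofReal, h]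
      · intro a _ hab
        have : ¬ ((a : ℕ) = b + 1) := fun h => hab (Fin.ext (by simpa using h))
        simp only [spinMinus, spinPlus, Matrix.conjTranspose_apply, Matrix.of_apply, if_neg this,
          star_zero, map_zero, zero_mul]
      · simp

theorem toPoly_casimir {i j : ι} (hij : i ≠ j) (k : ℕ) (ψ : SpinSpace k ι) :
    toPoly k (Matrix.toEuclideanLin (casimir k {i, j}) ψ) = pairCasimir k i j (toPoly k ψ) := by
  have h := ((Intertwines.sum (s := {i, j}) (intertwines_spinZ k)).mul
    (Intertwines.sum (s := {i, j}) (intertwines_spinZ k))).add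
    (Intertwines.smul (1 / 2 : ℂ)
      (((Intertwines.sum (s := {i, j}) (intertwines_spinPlus k)).mul
        (Intertwines.sum (s := {i, j}) (intertwines_spinMinus k))).add
      ((Intertwines.sum (s := {i, j}) (intertwines_spinMinus k)).mul
        (Intertwines.sum (s := {i, j}) (intertwines_spinPlus k))))) ψ
  rw [casimir, h]
  generalize toPoly k ψ = p
  -- `ring` treats `C (1 / 2)` as an atom; this relation is all it needs to know about it.
  have h2 : (C (1 / 2) : MvPolynomial ι ℂ) * 2 = 1 := by
    rw [← map_ofNat C 2, ← map_mul]; norm_num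
  simp only [Finset.sum_pair hij, polyZ, polyPlus, polyMinus, LinearMap.add_apply,
    LinearMap.sub_apply, LinearMap.smul_apply, Module.End.mul_apply, Module.End.one_apply,
    LinearMap.mulLeft_apply, Derivation.coeFn_coe, smul_eq_C_mul,
    pairCasimir, pairDiff, map_add, map_sub, pderiv_mul, pderiv_C, pderiv_X_self,
    pderiv_X_of_ne hij, pderiv_X_of_ne hij.symm, pderiv_pow, pderiv_comm j i, map_mul,
    div_eq_mul_one_div (k : ℂ) 2, map_one]
  set c : MvPolynomial ι ℂ := C (1 / 2)
  set K : MvPolynomial ι ℂ := C (k : ℂ)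
  linear_combination (K * (2 * K * c + K) * p
    - 2 * K * (X i * pderiv i p + X j * pderiv j p)
    + (K * (X i + X j) * (pderiv i p + pderiv j p)
      - X i ^ 2 * (pderiv i (pderiv i p) + pderiv i (pderiv j p))
      - X j ^ 2 * (pderiv i (pderiv j p) + pderiv j (pderiv j p))
      + K * p - X i * pderiv i p - X j * pderiv j p)) * h2

end Representation

/-! ### Fusion of spins as multiplication of polynomials -/

section Fuse

variable {ι : Type} [Fintype ι] [DecidableEq ι]

/-- The denominator of the Clebsch-Gordan coefficient is exactly the normalization of the target
monomial, so only the product of the source normalizations survives. -/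
theorem fuse_mul_sqrtChoose {k₁ k₂ k : ℕ} (p : Fin (k₁ + 1) × Fin (k₂ + 1))
    (c : Fin (k + 1)) :
    fuse k₁ k₂ k c p * sqrtChoose k c =
      if (c : ℕ) = p.1 + p.2 then sqrtChoose k₁ p.1 * sqrtChoose k₂ p.2 else 0 := by
  rw [fuse, Matrix.of_apply]
  split_ifs with h
  · have h0 : (0 : ℝ) < k.choose c := by
      exact_mod_cast Nat.choose_pos (Nat.lt_succ_iff.1 c.2)
    simp only [sqrtChoose]
    rw [← Complex.ofReal_mul, ← Complex.ofReal_mul, ← Real.sqrt_mul (by positivity),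
      div_mul_cancel₀ _ h0.ne', Real.sqrt_mul (Nat.cast_nonneg _)]
  · rw [zero_mul]

theorem sum_fuse_mul {k₁ k₂ k : ℕ} (hk : k₁ + k₂ = k) (p : Fin (k₁ + 1) × Fin (k₂ + 1)) (i : ι) :
    ∑ c, C (fuse k₁ k₂ k c p) * (C (sqrtChoose k c) * X i ^ (c : ℕ)) =
      (C (sqrtChoose k₁ p.1) * X i ^ (p.1 : ℕ)) *
        (C (sqrtChoose k₂ p.2) * X i ^ (p.2 : ℕ) : MvPolynomial ι ℂ) := by
  have h1 := p.1.2
  have h2 := p.2.2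
  simp only [← mul_assoc, ← map_mul, fuse_mul_sqrtChoose]
  rw [Finset.sum_eq_single (⟨p.1 + p.2, by omega⟩ : Fin (k + 1))]
  · rw [if_pos rfl, map_mul, pow_add]; ring
  · intro c _ hc
    rw [if_neg fun h => hc (Fin.ext h), map_zero, zero_mul]
  · simp

theorem toPoly_siteMap_fuse {k₁ k₂ k : ℕ} (hk : k₁ + k₂ = k)
    (v : EuclideanSpace ℂ (ι → Fin (k₁ + 1) × Fin (k₂ + 1))) :
    toPoly k (siteMap (fuse k₁ k₂ k) v) =
      ∑ w, C (v w) * ∏ i, ((C (sqrtChoose k₁ (w i).1) * X i ^ ((w i).1 : ℕ)) *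
        (C (sqrtChoose k₂ (w i).2) * X i ^ ((w i).2 : ℕ))) := by
  simp only [toPoly_apply, siteMap, Matrix.toLpLin_apply, Matrix.mulVec, dotProduct,
    Matrix.of_apply, map_sum, Finset.sum_mul]
  rw [Finset.sum_comm]
  refine Finset.sum_congr rfl fun w _ => ?_
  simp only [← sum_fuse_mul hk]
  rw [Fintype.prod_sum, Finset.mul_sum]
  refine Finset.sum_congr rfl fun x _ => ?_
  rw [basisPoly, Finset.prod_mul_distrib (f := fun i => C (fuse k₁ k₂ k (x i) (w i))), map_mul,
    map_prod]
  ring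

theorem toPoly_siteMap_siteTensor {k₁ k₂ k : ℕ} (hk : k₁ + k₂ = k) (a : SpinSpace k₁ ι)
    (b : SpinSpace k₂ ι) :
    toPoly k (siteMap (fuse k₁ k₂ k) (siteTensor a b)) = toPoly k₁ a * toPoly k₂ b := by
  rw [toPoly_siteMap_fuse hk, toPoly_apply, toPoly_apply, Finset.sum_mul_sum,
    ← Fintype.sum_prod_type', ← (Equiv.arrowProdEquivProdArrow ι _ _).sum_comp]
  refine Finset.sum_congr rfl fun w _ => ?_
  simp only [siteTensor, Equiv.arrowProdEquivProdArrow, Equiv.coe_fn_mk, basisPoly,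
    Finset.prod_mul_distrib, map_mul]
  ring

theorem toPoly_polarized (k : ℕ) : toPoly k (polarized k : SpinSpace k ι) = 1 := by
  rw [toPoly_apply, Finset.sum_eq_single (fun _ => 0)]
  · simp [polarized, basisPoly, sqrtChoose]
  · intro x _ hx
    simp [polarized, hx]
  · simp

end Fuse

/-! ### The valence-bond state as a product over bonds -/

section Bonds

/-- The bond operator `∑ B a b Xᵢ ^ a Xⱼ ^ b` of two spins 1/2 in the state `B`. -/
noncomputable def bondPoly {σ : Type} (B : Matrix (Fin 2) (Fin 2) ℂ) (i j : σ) :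
    MvPolynomial σ ℂ :=
  ∑ p : Fin 2 × Fin 2, C (B p.1 p.2) * (X i ^ (p.1 : ℕ) * X j ^ (p.2 : ℕ))

theorem bondPoly_singlet {σ : Type} (i j : σ) :
    bondPoly singlet i j = (X i - X j) * C (-((Real.sqrt 2 : ℝ) : ℂ)⁻¹) := by
  simp [bondPoly, Fintype.sum_prod_type, singlet]
  ring

theorem bondPoly_ne_zero {σ : Type} {B : Matrix (Fin 2) (Fin 2) ℂ} (hB : B ≠ 0) {i j : σ}
    (hij : i ≠ j) : bondPoly B i j ≠ 0 := by
  classical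
  intro h
  -- A bilinear polynomial is determined by its values at the four points with coordinates 0 and 1.
  have ev : ∀ s t : ℂ, B 0 0 + B 0 1 * t + (B 1 0 * s + B 1 1 * (s * t)) = 0 := by
    intro s t
    have := congrArg (eval fun l => if l = i then s else t) h
    simpa [bondPoly, Fintype.sum_prod_type, hij.symm] using this
  apply hB
  have h00 := ev 0 0
  have h01 := ev 0 1
  have h10 := ev 1 0
  have h11 := ev 1 1
  have e01 : B 0 1 = 0 := by linear_combination h01 - h00
  have e10 : B 1 0 = 0 := by linear_combination h10 - h00
  have e00 : B 0 0 = 0 := by linear_combination h00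
  have e11 : B 1 1 = 0 := by linear_combination h11 - h01 - h10 + h00
  ext a b
  fin_cases a <;> fin_cases b <;> assumption

theorem singlet_ne_zero : singlet ≠ 0 := by
  intro h
  have := congrFun (congrFun h 0) 1
  simp [singlet] at this

variable (N : ℕ) [NeZero N] (E : Matrix (Fin 2) (Fin 2) ℂ)

/-- The state of the bond `(i, i + 1)`. -/
noncomputable def bondState (i : Fin N) : Matrix (Fin 2) (Fin 2) ℂ :=
  if (i : ℕ) + 1 < N then singlet else E

/-- Regrouping the virtual spins by bonds. -/
def bondEquiv : (Fin N → Fin 2 × Fin 2) ≃ (Fin N → Fin 2 × Fin 2) where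
  toFun v i := ((v i).2, (v (i + 1)).1)
  invFun w i := ((w (i - 1)).2, (w i).1)
  left_inv v := by simp
  right_inv w := by simp

theorem valenceBonds_apply (v : Fin N → Fin 2 × Fin 2) :
    valenceBonds N E v = ∏ i, bondState N E i (v i).2 (v (i + 1)).1 := by
  change (∏ i : Fin N, if (i : ℕ) + 1 < N then singlet (v i).2 (v (i + 1)).1
    else E (v i).2 (v (i + 1)).1) = _
  refine Finset.prod_congr rfl fun i _ => ?_
  rw [bondState]
  split_ifs <;> rfl

theorem sqrtChoose_one (a : Fin 2) : sqrtChoose 1 a = 1 := by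
  fin_cases a <;> simp [sqrtChoose]

/-- The AKLT state is the product of its valence bonds. -/
theorem toPoly_aklt :
    toPoly 2 (aklt N E) = ∏ i, bondPoly (bondState N E i) i (i + 1) := by
  rw [aklt, toPoly_siteMap_fuse (show 1 + 1 = 2 from rfl)]
  simp only [bondPoly]
  rw [Fintype.prod_sum]
  refine Fintype.sum_equiv (bondEquiv N) _ _ fun v => ?_
  rw [valenceBonds_apply, map_prod]
  simp only [sqrtChoose_one, map_one, one_mul, bondEquiv, Equiv.coe_fn_mk]
  simp only [Finset.prod_mul_distrib]
  -- Bond i carries the left virtual spin of site i + 1, so the left factors are reindexed by the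
  -- cyclic shift.
  have := Equiv.prod_comp (Equiv.addRight (1 : Fin N))
    fun i => (X i : MvPolynomial (Fin N) ℂ) ^ ((v i).1 : ℕ)
  simp only [Equiv.coe_addRight] at this
  rw [this]
  ring

theorem toPoly_partialFerro {n : ℕ} (hn : 2 ≤ n) :
    toPoly n (partialFerro n N E) = ∏ i, bondPoly (bondState N E i) i (i + 1) := by
  rw [partialFerro, toPoly_siteMap_siteTensor (by omega), toPoly_polarized, mul_one, toPoly_aklt]

variable {N E}

theorem ne_add_one (hN : 2 ≤ N) (i : Fin N) : i ≠ i + 1 := by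
  intro h
  have h1 : (1 : Fin N) = 0 := by simpa using h.symm
  have := congrArg Fin.val h1
  rw [Fin.val_one', Nat.mod_eq_of_lt (by omega)] at this
  simp at this

theorem partialFerro_ne_zero {n : ℕ} (hn : 2 ≤ n) (hN : 2 ≤ N) (hE : E ≠ 0) :
    partialFerro n N E ≠ 0 := by
  intro h
  have h' := toPoly_partialFerro N E hn
  rw [h, map_zero, eq_comm, Finset.prod_eq_zero_iff] at h'
  obtain ⟨i, -, hi⟩ := h'
  refine bondPoly_ne_zero ?_ (ne_add_one hN i) hi
  rw [bondState]
  split_ifs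
  exacts [singlet_ne_zero, hE]

theorem exists_toPoly_partialFerro_eq {n : ℕ} (hn : 2 ≤ n) {i : Fin N}
    (hi : bondState N E i = singlet) :
    ∃ q, toPoly n (partialFerro n N E) = (X i - X (i + 1)) * q := by
  rw [toPoly_partialFerro N E hn, ← Finset.mul_prod_erase _ _ (Finset.mem_univ i), hi,
    bondPoly_singlet, mul_assoc]
  exact ⟨_, rfl⟩

theorem degreeOf_toPoly_partialFerro_le {n : ℕ} (hn : 2 ≤ n) (l : Fin N) :
    (toPoly n (partialFerro n N E)).degreeOf l ≤ 2 := by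
  rw [toPoly_partialFerro N E hn, ← toPoly_aklt]
  exact degreeOf_toPoly_le 2 _ l

end Bonds

/-! ### Eigenspace decomposition from a product of linear factors -/

section Eigenspaces

variable {V : Type} [AddCommGroup V] [Module ℂ V]

theorem mem_eigenspace_sup (A : Module.End ℂ V) {a b : ℂ} (hab : a ≠ b) {v : V}
    (h : A v - a • v ∈ A.eigenspace b) : v ∈ A.eigenspace b ⊔ A.eigenspace a := by
  have hba : b - a ≠ 0 := sub_ne_zero.2 hab.symm
  refine Submodule.mem_sup.2 ⟨_, Submodule.smul_mem _ (b - a)⁻¹ h, v - (b - a)⁻¹ • (A v - a • v),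
    ?_, by abel⟩
  rw [Module.End.mem_eigenspace_iff] at h ⊢
  rw [map_sub, map_smul, h]
  match_scalars <;> field_simp <;> ring

/-- The vector (A - a) v splits into a c-part and a b-part; dividing these by c - a and b - a
recovers the components of v, and the remainder is an a-eigenvector. -/
theorem mem_eigenspace_sup_sup (A : Module.End ℂ V) {a b c : ℂ} (hab : a ≠ b) (hac : a ≠ c)
    (hbc : b ≠ c) {v w : V} (hw : w = A v - a • v) (h : A w - b • w ∈ A.eigenspace c) :
    v ∈ A.eigenspace c ⊔ (A.eigenspace b ⊔ A.eigenspace a) := by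
  obtain ⟨w₁, h₁, w₂, h₂, hs⟩ := Submodule.mem_sup.1 (mem_eigenspace_sup A hbc h)
  have hca : c - a ≠ 0 := sub_ne_zero.2 hac.symm
  have hba : b - a ≠ 0 := sub_ne_zero.2 hab.symm
  refine Submodule.mem_sup.2 ⟨_, Submodule.smul_mem _ (c - a)⁻¹ h₁,
    (b - a)⁻¹ • w₂ + (v - (c - a)⁻¹ • w₁ - (b - a)⁻¹ • w₂),
    Submodule.add_mem_sup (Submodule.smul_mem _ _ h₂) ?_, by abel⟩
  rw [Module.End.mem_eigenspace_iff] at h₁ h₂ ⊢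
  have hv : A v = a • v + (w₁ + w₂) := by rw [hs, hw]; abel
  rw [map_sub, map_sub, map_smul, map_smul, h₁, h₂, hv]
  match_scalars <;> field_simp <;> ring

end Eigenspaces

/-! ### Total-spin sectors and the zero-energy property -/

section Sectors

variable {ι : Type} [Fintype ι] [DecidableEq ι]

theorem conjTranspose_siteOp {α : Type} [DecidableEq α] (A : Matrix α α ℂ) (i : ι) :
    (siteOp A i).conjTranspose = siteOp A.conjTranspose i := by
  ext x y
  simp only [siteOp, Matrix.conjTranspose_apply, Matrix.of_apply, eq_comm (a := y _)]
  split_ifs <;> simp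

theorem isHermitian_casimir (k : ℕ) (s : Finset ι) : (casimir k s).IsHermitian := by
  have hz : (spinZ k).conjTranspose = spinZ k := by
    rw [spinZ, Matrix.diagonal_conjTranspose]
    congr 1
    funext a
    simp
  have hm : (spinMinus k).conjTranspose = spinPlus k := Matrix.conjTranspose_conjTranspose _
  rw [Matrix.IsHermitian, casimir]
  simp only [Matrix.conjTranspose_add, Matrix.conjTranspose_mul, Matrix.conjTranspose_smul,
    Matrix.conjTranspose_sum, conjTranspose_siteOp, hz, hm]
  simp [spinMinus]

theorem spinSector_isOrtho (k : ℕ) (s : Finset ι) {J J' : ℝ} (hJ : 0 ≤ J) (hJ' : 0 ≤ J')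
    (h : J ≠ J') : spinSector k s J ⟂ spinSector k s J' := by
  have hs := Matrix.isSymmetric_toEuclideanLin_iff.2 (isHermitian_casimir k s)
  refine hs.orthogonalFamily_eigenspaces.isOrtho ?_
  intro he
  rw [Complex.ofReal_inj] at he
  -- J(J + 1) is strictly increasing for J ≥ 0, so distinct spins have distinct Casimir eigenvalues.
  rcases lt_or_gt_of_ne h with h | h <;> nlinarith

/-- Two spins `n / 2` in a state `(Xᵢ - Xⱼ) q f` have total spin `n - 3`, `n - 2` or `n - 1`. -/
theorem mem_iSup_spinSector {i j : ι} (hij : i ≠ j) {n : ℕ} (hn : 5 ≤ n) {ψ : SpinSpace n ι}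
    {q f : MvPolynomial ι ℂ} (hψ : toPoly n ψ = (X i - X j) * (q * f))
    (hq : pderiv i (pderiv i q) = 0 ∧ pderiv j (pderiv j q) = 0)
    (hf : pairDiff ((n : ℂ) - 2) i j f = 0) :
    ψ ∈ ⨆ T ∈ ({n - 3, n - 2, n - 1} : Finset ℕ), spinSector n {i, j} (T : ℝ) := by
  have c₁ : ((((n - 1 : ℕ) : ℝ) * (((n - 1 : ℕ) : ℝ) + 1) : ℝ) : ℂ) = ((n : ℂ) - 1) * n := by
    rw [Nat.cast_sub (by omega)]; push_cast; ring
  have c₂ : ((((n - 2 : ℕ) : ℝ) * (((n - 2 : ℕ) : ℝ) + 1) : ℝ) : ℂ) =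
      ((n : ℂ) - 2) * (n - 1) := by
    rw [Nat.cast_sub (by omega)]; push_cast; ring
  have c₃ : ((((n - 3 : ℕ) : ℝ) * (((n - 3 : ℕ) : ℝ) + 1) : ℝ) : ℂ) =
      ((n : ℂ) - 3) * (n - 2) := by
    rw [Nat.cast_sub (by omega)]; push_cast; ring
  simp only [Finset.iSup_insert, Finset.iSup_singleton, spinSector, c₁, c₂, c₃]
  have h5 : (5 : ℝ) ≤ n := by exact_mod_cast hn
  set A := Matrix.toEuclideanLin (casimir n {i, j}) with hA
  set w := A ψ - (((n : ℂ) - 1) * n) • ψ with hw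
  refine mem_eigenspace_sup_sup A ?_ ?_ ?_ hw ?_
  · intro h
    have : ((n : ℝ) - 1) * n = (n - 2) * (n - 1) := by exact_mod_cast h
    nlinarith
  · intro h
    have : ((n : ℝ) - 1) * n = (n - 3) * (n - 2) := by exact_mod_cast h
    nlinarith
  · intro h
    have : ((n : ℝ) - 2) * (n - 1) = (n - 3) * (n - 2) := by exact_mod_cast h
    nlinarith
  · rw [Module.End.mem_eigenspace_iff, ← sub_eq_zero]
    apply toPoly_injective n
    rw [map_zero]
    refine pairCasimir_cubic hij hq.1 hq.2 hf (p₁ := toPoly n w)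
      (p₂ := toPoly n (A w - (((n : ℂ) - 2) * (n - 1)) • w)) ?_ ?_ ?_
    · rw [hw, map_sub, toPoly_casimir hij, map_smul, smul_eq_C_mul, hψ]
    · rw [map_sub, toPoly_casimir hij, map_smul, smul_eq_C_mul]
    · rw [map_sub, toPoly_casimir hij, map_smul, smul_eq_C_mul]

/-- The projectors of the Hamiltonian annihilate states of the form `(Xᵢ - Xⱼ) q`. -/
theorem spinProjector_eq_zero {i j : ι} (hij : i ≠ j) {n : ℕ} (hn : 5 ≤ n) {ψ : SpinSpace n ι}
    {q : MvPolynomial ι ℂ} (hψ : toPoly n ψ = (X i - X j) * q)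
    (hd : ∀ l, (toPoly n ψ).degreeOf l ≤ 2) {T : ℕ} (hT : T ∈ setK n) :
    spinProjector n {i, j} (T : ℝ) ψ = 0 := by
  have hq := pderiv_pderiv_eq_zero_of_sub_mul hij (q := q) (hψ ▸ hd)
  -- The background is the polarized state, whose polynomial 1 is killed by every D_k.
  have hmem := mem_iSup_spinSector hij hn (q := q) (f := 1) (by rw [hψ, mul_one]) hq
    (by simp [pairDiff])
  have hle : (⨆ T ∈ ({n - 3, n - 2, n - 1} : Finset ℕ), spinSector n {i, j} (T : ℝ)) ≤
      (spinSector n {i, j} (T : ℝ))ᗮ := by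
    refine iSup₂_le fun T' hT' => ?_
    refine spinSector_isOrtho n {i, j} (Nat.cast_nonneg _) (Nat.cast_nonneg _) ?_
    rw [Ne, Nat.cast_inj]
    simp only [setK, Finset.mem_insert, Finset.mem_singleton, Finset.mem_range] at hT hT'
    omega
  rw [spinProjector, Submodule.starProjection_apply,
    Submodule.orthogonalProjectionOnto_eq_zero_iff.2 (hle hmem), ZeroMemClass.coe_zero]

theorem isPositive_hamiltonian {n N : ℕ} [NeZero N] {J : ℕ → ℝ} (hJ : ∀ T ∈ setK n, 0 < J T)
    (bonds : Finset (Fin N)) : (hamiltonian n N J bonds).IsPositive := by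
  refine ContinuousLinearMap.isPositive_sum _ fun i _ =>
    ContinuousLinearMap.isPositive_sum _ fun T hT => ?_
  refine ContinuousLinearMap.IsPositive.smul_of_nonneg ?_ ?_
  · exact ContinuousLinearMap.IsPositive.of_isStarProjection isStarProjection_starProjection
  · exact_mod_cast (hJ T hT).le

theorem isZeroEnergyGroundState_partialFerro {n N : ℕ} [NeZero N] (hn : 5 ≤ n) (hN : 2 ≤ N)
    {J : ℕ → ℝ} (hJ : ∀ T ∈ setK n, 0 < J T) {bonds : Finset (Fin N)}
    {E : Matrix (Fin 2) (Fin 2) ℂ} (hE : E ≠ 0) (hb : ∀ i ∈ bonds, bondState N E i = singlet) :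
    IsZeroEnergyGroundState (hamiltonian n N J bonds) (partialFerro n N E) := by
  refine ⟨isPositive_hamiltonian hJ bonds, partialFerro_ne_zero (by omega) hN hE, ?_⟩
  rw [hamiltonian, sum_apply]
  refine Finset.sum_eq_zero fun i hi => ?_
  rw [sum_apply]
  refine Finset.sum_eq_zero fun T hT => ?_
  obtain ⟨q, hq⟩ := exists_toPoly_partialFerro_eq (n := n) (by omega) (hb i hi)
  rw [smul_apply, spinProjector_eq_zero (ne_add_one hN i) hn hq
    (degreeOf_toPoly_partialFerro_le (by omega)) hT, smul_zero]

end Sectors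

/-! ### The two-site space V -/

section PairSpace

theorem univ_fin_two : (Finset.univ : Finset (Fin 2)) = {0, 1} := rfl

theorem fin_two_ne : (0 : Fin 2) ≠ 1 := by decide

theorem toPoly_eq_of_mem_spinSector {k : ℕ} {J : ℝ} {ψ : SpinSpace k (Fin 2)}
    (h : ψ ∈ spinSector k Finset.univ J) :
    pairCasimir k 0 1 (toPoly k ψ) = C ((J : ℂ) * (J + 1)) * toPoly k ψ := by
  rw [spinSector, Module.End.mem_eigenspace_iff, univ_fin_two] at h
  rw [← toPoly_casimir fin_two_ne, h, map_smul, smul_eq_C_mul]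
  push_cast
  rfl

/-- The value 6 = 2 · 3 belongs to total spin 2. For any other eigenvalue the equation (6 - c) p = u
D_2 p exhibits the factor u. -/
theorem exists_eq_sub_mul {p : MvPolynomial (Fin 2) ℂ} {c : ℂ} (hc : c ≠ 6)
    (h : pairCasimir 2 0 1 p = C c * p) : ∃ q, p = (X 0 - X 1) * q := by
  have h6 : (6 - c) ≠ 0 := sub_ne_zero.2 hc.symm
  refine ⟨C (6 - c)⁻¹ * pairDiff 2 0 1 p, ?_⟩
  have hi : (C (6 - c)⁻¹ * (C 6 - C c) : MvPolynomial (Fin 2) ℂ) = 1 := by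
    rw [← map_sub, ← map_mul, inv_mul_cancel₀ h6, map_one]
  rw [pairCasimir, show (2 : ℂ) * (2 + 1) = 6 by norm_num] at h
  linear_combination (-p) * hi + C (6 - c)⁻¹ * h

theorem pairSpace_le {n : ℕ} (hn : 5 ≤ n) :
    pairSpace n ≤ ⨆ T ∈ ({n - 3, n - 2, n - 1} : Finset ℕ),
      spinSector n (Finset.univ : Finset (Fin 2)) (T : ℝ) := by
  rw [pairSpace, Submodule.map_span_le]
  rintro _ ⟨a, ha, f, hf, rfl⟩
  obtain ⟨a₀, h₀, a₁, h₁, rfl⟩ := Submodule.mem_sup.1 ha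
  obtain ⟨q₀, hq₀⟩ := exists_eq_sub_mul (p := toPoly 2 a₀) (c := 0) (by norm_num)
    (by simpa using toPoly_eq_of_mem_spinSector h₀)
  obtain ⟨q₁, hq₁⟩ := exists_eq_sub_mul (p := toPoly 2 a₁) (c := 2) (by norm_num)
    (by have h := toPoly_eq_of_mem_spinSector h₁; norm_num at h; exact h)
  have hq : toPoly 2 (a₀ + a₁) = (X 0 - X 1) * (q₀ + q₁) := by
    rw [map_add, hq₀, hq₁]; ring
  have hu : (X 0 - X 1 : MvPolynomial (Fin 2) ℂ) ≠ 0 :=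
    sub_ne_zero.2 fun h => fin_two_ne (X_injective h)
  rw [univ_fin_two]
  refine mem_iSup_spinSector fin_two_ne hn (q := q₀ + q₁) (f := toPoly (n - 2) f) ?_
    (pderiv_pderiv_eq_zero_of_sub_mul fin_two_ne (hq ▸ degreeOf_toPoly_le 2 _)) ?_
  · rw [toPoly_siteMap_siteTensor (by omega), hq, mul_assoc]
  · have h := toPoly_eq_of_mem_spinSector hf
    have e : ((n - 2 : ℕ) : ℂ) = n - 2 := by rw [Nat.cast_sub (by omega)]; rfl
    rw [pairCasimir, e] at h
    push_cast at h
    -- At the maximal total spin the eigenvalue equation reduces to u D f = 0, and u can be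
    -- cancelled.
    exact (mul_eq_zero.1 (by linear_combination -h)).resolve_left hu

/-- By the degree bound the same polynomial is also a state of two spins 1, of total spin 0 or 1 by
`pairCasimir_quadratic`; tensoring with the polarized state multiplies it by 1. -/
theorem mem_pairSpace {n : ℕ} (hn : 5 ≤ n) {ψ : SpinSpace n (Fin 2)}
    {q : MvPolynomial (Fin 2) ℂ} (hψ : toPoly n ψ = (X 0 - X 1) * q)
    (hd : ∀ l, (toPoly n ψ).degreeOf l ≤ 2) : ψ ∈ pairSpace n := by
  obtain ⟨a, ha⟩ := exists_toPoly_eq hd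
  have hq := pderiv_pderiv_eq_zero_of_sub_mul fin_two_ne (q := q) (hψ ▸ hd)
  refine Submodule.mem_map.2 ⟨_, Submodule.subset_span
    ⟨a, ?_, (polarized (n - 2) : SpinSpace (n - 2) (Fin 2)), ?_, rfl⟩, ?_⟩
  · rw [spinSector, spinSector]
    refine mem_eigenspace_sup _ (by norm_num) ?_
    rw [Module.End.mem_eigenspace_iff, univ_fin_two]
    apply toPoly_injective 2
    rw [toPoly_casimir fin_two_ne, map_smul]
    norm_num
    refine pairCasimir_quadratic fin_two_ne hq.1 hq.2 ?_
    rw [toPoly_casimir fin_two_ne, ha, hψ, smul_eq_C_mul]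
    norm_num
  · rw [spinSector, Module.End.mem_eigenspace_iff, univ_fin_two]
    apply toPoly_injective (n - 2)
    have e : ((n - 2 : ℕ) : ℂ) = n - 2 := by rw [Nat.cast_sub (by omega)]; rfl
    rw [toPoly_casimir fin_two_ne, map_smul, toPoly_polarized, pairCasimir, e, smul_eq_C_mul]
    simp [pairDiff]
  · apply toPoly_injective n
    rw [toPoly_siteMap_siteTensor (by omega), ha, toPoly_polarized, mul_one]

end PairSpace

/-! ### Slices and reduced density matrices -/

section Slices

variable {ι κ : Type} [Fintype ι] [DecidableEq ι] [Fintype κ] [DecidableEq κ]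

theorem degreeOf_toPoly_le_iff {k d : ℕ} {ψ : SpinSpace k ι} {i : ι} :
    (toPoly k ψ).degreeOf i ≤ d ↔ ∀ x, ψ x ≠ 0 → (x i : ℕ) ≤ d := by
  constructor
  · intro h x hx
    refine degreeOf_le_iff.1 h (exponents x) (mem_support_iff.2 ?_)
    rw [coeff_toPoly]
    exact mul_ne_zero hx (prod_sqrtChoose_ne_zero x)
  · intro h
    rw [toPoly_apply]
    refine (degreeOf_sum_le _ _ _).trans (Finset.sup_le fun x _ => ?_)
    rw [basisPoly_eq_monomial, C_mul_monomial]
    refine degreeOf_le_iff.2 fun m hm => ?_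
    have hm' := Finset.mem_singleton.1 (support_monomial_subset hm)
    rw [hm'] at hm ⊢
    refine h x fun h0 => ?_
    simp [h0] at hm

/-- The state of the sites `e` when the other sites are in the basis state `y`. -/
noncomputable def slice {k : ℕ} (ψ : SpinSpace k ι) (e : κ ↪ ι) (y : ι → Fin (k + 1)) :
    SpinSpace k κ :=
  WithLp.toLp 2 fun u => ∑ x : ι → Fin (k + 1),
    if x ∘ e = u ∧ ∀ j, (∀ t, e t ≠ j) → x j = y j then ψ x else 0

theorem degreeOf_toPoly_slice_le {k d : ℕ} {ψ : SpinSpace k ι} {e : κ ↪ ι}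
    {y : ι → Fin (k + 1)} {t : κ} (h : (toPoly k ψ).degreeOf (e t) ≤ d) :
    (toPoly k (slice ψ e y)).degreeOf t ≤ d := by
  rw [degreeOf_toPoly_le_iff] at h ⊢
  intro u hu
  obtain ⟨x, -, hx⟩ := Finset.exists_ne_zero_of_sum_ne_zero hu
  rw [ite_ne_right_iff] at hx
  rw [← hx.1.1]
  exact h x hx.2

/-- The variables of the sites `e` become coefficients. -/
noncomputable def separate (e : κ ↪ ι) :
    MvPolynomial ι ℂ →ₐ[ℂ] MvPolynomial ι (MvPolynomial κ ℂ) :=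
  open scoped Classical in
  aeval fun l => if h : ∃ t, e t = l then C (X h.choose) else X l

theorem separate_X (e : κ ↪ ι) (t : κ) : separate e (X (e t)) = C (X t) := by
  have h : ∃ s, e s = e t := ⟨t, rfl⟩
  rw [separate, aeval_X, dif_pos h, e.injective h.choose_spec]

theorem separate_X_of_notMem (e : κ ↪ ι) {l : ι} (hl : ∀ t, e t ≠ l) :
    separate e (X l) = X l := by
  rw [separate, aeval_X, dif_neg fun ⟨t, ht⟩ => hl t ht]

theorem separate_C (e : κ ↪ ι) (c : ℂ) : separate e (C c) = C (C c) :=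
  (separate e).commutes c

/-- The sites outside `e`. -/
def environment (e : κ ↪ ι) : Finset ι := Finset.univ \ Finset.univ.map e

theorem mem_environment {e : κ ↪ ι} {l : ι} : l ∈ environment e ↔ ∀ t, e t ≠ l := by
  simp [environment]

/-- The exponents of the sites outside `e`. -/
noncomputable def envExponents {k : ℕ} (e : κ ↪ ι) (x : ι → Fin (k + 1)) : ι →₀ ℕ :=
  ∑ l ∈ environment e, Finsupp.single l (x l : ℕ)

theorem envExponents_eq_iff {k : ℕ} {e : κ ↪ ι} {x y : ι → Fin (k + 1)} :
    envExponents e x = envExponents e y ↔ ∀ j, (∀ t, e t ≠ j) → x j = y j := by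
  have happ : ∀ (z : ι → Fin (k + 1)) j, j ∈ environment e → envExponents e z j = z j := by
    intro z j hj
    rw [envExponents, Finsupp.finsetSum_apply, Finset.sum_eq_single j]
    · simp
    · intro l _ hl; simp [hl]
    · exact fun h => absurd hj h
  constructor
  · intro h j hj
    have := DFunLike.congr_fun h j
    rw [happ x j (mem_environment.2 hj), happ y j (mem_environment.2 hj)] at this
    exact Fin.ext this
  · intro h
    exact Finset.sum_congr rfl fun l hl => by rw [h l (mem_environment.1 hl)]

theorem separate_basisPoly {k : ℕ} (e : κ ↪ ι) (x : ι → Fin (k + 1)) :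
    separate e (basisPoly k x) = monomial (envExponents e x)
      (C (∏ l ∈ environment e, sqrtChoose k (x l)) * basisPoly k (x ∘ e)) := by
  have h1 : ∏ l ∈ environment e, separate e (C (sqrtChoose k (x l)) * X l ^ (x l : ℕ)) =
      C (C (∏ l ∈ environment e, sqrtChoose k (x l))) * monomial (envExponents e x) 1 := by
    rw [envExponents, monomial_sum_index, map_one, one_mul, map_prod, map_prod,
      ← Finset.prod_mul_distrib]
    refine Finset.prod_congr rfl fun l hl => ?_
    rw [map_mul, map_pow, separate_C, separate_X_of_notMem e (mem_environment.1 hl),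
      X_pow_eq_monomial]
  have h2 : ∏ t, separate e (C (sqrtChoose k (x (e t))) * X (e t) ^ (x (e t) : ℕ)) =
      C (basisPoly k (x ∘ e)) := by
    rw [basisPoly, map_prod]
    refine Finset.prod_congr rfl fun t _ => ?_
    rw [map_mul, map_pow, separate_C, separate_X, map_mul, map_pow]
    rfl
  rw [basisPoly, map_prod, ← Finset.prod_sdiff (Finset.subset_univ (Finset.univ.map e)),
    Finset.prod_map, h2]
  change (∏ l ∈ environment e, _) * _ = _
  rw [h1, mul_right_comm, ← map_mul, C_mul_monomial, mul_one]

theorem coeff_separate_toPoly {k : ℕ} (e : κ ↪ ι) (ψ : SpinSpace k ι) (y : ι → Fin (k + 1)) :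
    coeff (envExponents e y) (separate e (toPoly k ψ)) =
      C (∏ l ∈ environment e, sqrtChoose k (y l)) * toPoly k (slice ψ e y) := by
  have hs : toPoly k (slice ψ e y) = ∑ x : ι → Fin (k + 1),
      if ∀ j, (∀ t, e t ≠ j) → x j = y j then C (ψ x) * basisPoly k (x ∘ e) else 0 := by
    rw [toPoly_apply]
    simp only [slice, map_sum, Finset.sum_mul]
    rw [Finset.sum_comm]
    refine Finset.sum_congr rfl fun x _ => ?_
    rw [Finset.sum_eq_single (x ∘ e)]
    · simp only [true_and]
      split_ifs <;> simp
    · intro u _ hu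
      rw [if_neg fun h => hu h.1.symm, map_zero, zero_mul]
    · simp
  rw [hs, toPoly_apply, map_sum, coeff_sum, Finset.mul_sum]
  refine Finset.sum_congr rfl fun x _ => ?_
  rw [map_mul, separate_C, coeff_C_mul, separate_basisPoly, coeff_monomial]
  simp only [envExponents_eq_iff]
  split_ifs with h
  · have : ∏ l ∈ environment e, sqrtChoose k (x l) = ∏ l ∈ environment e, sqrtChoose k (y l) :=
      Finset.prod_congr rfl fun l hl => by rw [h l (mem_environment.1 hl)]
    rw [this]; ring
  · simp

/-- `separate` is multiplicative and sends the difference of the two variables to a constant of the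
outer polynomial ring, so this factor comes out of every coefficient. -/
theorem exists_toPoly_slice_eq {k : ℕ} {e : κ ↪ ι} {ψ : SpinSpace k ι} {s t : κ}
    {q : MvPolynomial ι ℂ} (h : toPoly k ψ = (X (e s) - X (e t)) * q) (y : ι → Fin (k + 1)) :
    ∃ q', toPoly k (slice ψ e y) = (X s - X t) * q' := by
  have h0 : ∏ l ∈ environment e, sqrtChoose k (y l) ≠ 0 :=
    Finset.prod_ne_zero_iff.2 fun i _ => sqrtChoose_ne_zero (Nat.lt_succ_iff.1 (y i).2)
  have hc := coeff_separate_toPoly e ψ y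
  rw [h, map_mul, map_sub, separate_X, separate_X, ← map_sub, coeff_C_mul] at hc
  refine ⟨C (∏ l ∈ environment e, sqrtChoose k (y l))⁻¹ *
    coeff (envExponents e y) (separate e q), ?_⟩
  rw [mul_left_comm, hc, ← mul_assoc, ← map_mul, inv_mul_cancel₀ h0, map_one, one_mul]

/-- A slice depends only on the values of y outside e. Summing over all of y lets its values on e
contract with the input vector c. -/
theorem range_reducedDensity_le {k : ℕ} {ψ : SpinSpace k ι} {e : κ ↪ ι}
    {W : Submodule ℂ (SpinSpace k κ)} (h : ∀ y, slice ψ e y ∈ W) :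
    LinearMap.range (Matrix.toEuclideanLin (reducedDensity ψ e)) ≤ W := by
  rintro _ ⟨c, rfl⟩
  have : Matrix.toEuclideanLin (reducedDensity ψ e) c =
      ∑ y, (conj (ψ y) * c (y ∘ e)) • slice ψ e y := by
    ext u
    simp only [Matrix.toLpLin_apply, Matrix.mulVec, dotProduct, reducedDensity, Matrix.of_apply,
      WithLp.ofLp_sum, Finset.sum_apply, WithLp.ofLp_smul, Pi.smul_apply, slice, smul_eq_mul,
      Finset.sum_mul, Finset.mul_sum]
    rw [Finset.sum_comm]
    refine Eq.trans (Finset.sum_congr rfl fun x _ => Finset.sum_comm) ?_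
    rw [Finset.sum_comm]
    refine Finset.sum_congr rfl fun y _ => Finset.sum_congr rfl fun x _ => ?_
    rw [Finset.sum_eq_single (y ∘ e)]
    · simp only [true_and]
      split_ifs <;> ring
    · intro v _ hv
      rw [if_neg fun h => hv h.2.1.symm, zero_mul]
    · simp
  rw [this]
  exact Submodule.sum_mem _ fun y _ => Submodule.smul_mem _ _ (h y)

end Slices

theorem range_reducedDensity_partialFerro_le {n N : ℕ} [NeZero N] (hn : 5 ≤ n) (hN : 2 ≤ N)
    {E : Matrix (Fin 2) (Fin 2) ℂ} {i : Fin N} (hi : bondState N E i = singlet) :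
    LinearMap.range (Matrix.toEuclideanLin
      (reducedDensity (partialFerro n N E) ![i, i + 1])) ≤ pairSpace n := by
  have hinj : Function.Injective ![i, i + 1] := by
    intro a b
    have := ne_add_one hN i
    fin_cases a <;> fin_cases b <;> simp [this, this.symm]
  refine range_reducedDensity_le (e := ⟨![i, i + 1], hinj⟩) fun y => ?_
  obtain ⟨q, hq⟩ := exists_toPoly_partialFerro_eq (n := n) (by omega) hi
  obtain ⟨q', hq'⟩ := exists_toPoly_slice_eq (e := ⟨![i, i + 1], hinj⟩) (s := 0) (t := 1)
    hq y
  exact mem_pairSpace hn hq' fun l =>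
    degreeOf_toPoly_slice_le (degreeOf_toPoly_partialFerro_le (by omega) _)

/-! ### Magnetization from spin reversal -/

section Magnetization

theorem fuse_rev (c : Fin 3) (p : Fin 2 × Fin 2) :
    fuse 1 1 2 c.rev (p.1.rev, p.2.rev) = fuse 1 1 2 c p := by
  obtain ⟨l, r⟩ := p
  fin_cases c <;> fin_cases l <;> fin_cases r <;> simp [fuse, Fin.rev]

theorem singlet_rev (a b : Fin 2) : singlet a.rev b.rev = -singlet a b := by
  fin_cases a <;> fin_cases b <;> simp [singlet, Fin.rev]

variable (N : ℕ) [NeZero N]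

theorem bondState_singlet (i : Fin N) : bondState N singlet i = singlet := by
  rw [bondState, ite_self]

theorem aklt_apply (x : Fin N → Fin 3) : aklt N singlet x =
    ∑ v : Fin N → Fin 2 × Fin 2, (∏ i, fuse 1 1 2 (x i) (v i)) *
      ∏ i, singlet (v i).2 (v (i + 1)).1 := by
  simp only [aklt, siteMap, Matrix.toLpLin_apply, Matrix.mulVec, dotProduct, Matrix.of_apply,
    valenceBonds_apply, bondState_singlet]

/-- The AKLT state is invariant, up to a sign, under the reversal of all spins. -/
theorem aklt_rev (x : Fin N → Fin 3) :
    aklt N singlet (fun i => (x i).rev) = (-1) ^ N * aklt N singlet x := by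
  rw [aklt_apply, aklt_apply, Finset.mul_sum]
  symm
  refine Fintype.sum_equiv (Equiv.piCongrRight fun _ => Equiv.prodCongr Fin.revPerm Fin.revPerm)
    _ _ fun v => ?_
  simp only [Equiv.piCongrRight_apply, Pi.map_apply, Equiv.prodCongr_apply, Prod.map,
    Fin.revPerm_apply, fuse_rev, singlet_rev, Finset.prod_neg, Finset.card_univ, Fintype.card_fin]
  ring

/-- The AKLT state of the ring has total `S^z` equal to `0`. -/
theorem sum_eq_of_aklt_ne_zero {x : Fin N → Fin 3} (h : aklt N singlet x ≠ 0) :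
    ∑ i, (x i : ℕ) = N := by
  rw [aklt_apply] at h
  obtain ⟨v, -, hv⟩ := Finset.exists_ne_zero_of_sum_ne_zero h
  have h1 : ∀ i, (x i : ℕ) = (v i).1 + (v i).2 := fun i => by
    by_contra hne
    refine Finset.prod_ne_zero_iff.1 (left_ne_zero_of_mul hv) i (Finset.mem_univ i) ?_
    rw [fuse, Matrix.of_apply, if_neg hne]
  have h2 : ∀ i, ((v i).2 : ℕ) + (v (i + 1)).1 = 1 := fun i => by
    have := Finset.prod_ne_zero_iff.1 (right_ne_zero_of_mul hv) i (Finset.mem_univ i)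
    revert this
    generalize (v i).2 = a
    generalize (v (i + 1)).1 = b
    fin_cases a <;> fin_cases b <;> simp [singlet]
  have h3 := Equiv.sum_comp (Equiv.addRight (1 : Fin N)) fun i => ((v i).1 : ℕ)
  simp only [Equiv.coe_addRight] at h3
  simp only [h1, Finset.sum_add_distrib]
  rw [← h3, add_comm, ← Finset.sum_add_distrib]
  simp only [h2]
  simp

variable {N} {n : ℕ}

/-- The basis states of spins 1 as states of spins `n / 2`. -/
def embed (hn : 2 ≤ n) (x : Fin N → Fin 3) : Fin N → Fin (n + 1) :=
  fun i => Fin.castLE (by omega) (x i)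

/-- Both states have the same polynomial, so their amplitudes differ only by the normalization of
the monomials. -/
theorem partialFerro_embed (hn : 2 ≤ n) (x : Fin N → Fin 3) :
    partialFerro n N singlet (embed hn x) * ∏ i, sqrtChoose n (x i) =
      aklt N singlet x * ∏ i, sqrtChoose 2 (x i) := by
  have h1 := coeff_toPoly n (partialFerro n N singlet) (embed hn x)
  have h2 := coeff_toPoly 2 (aklt N singlet) x
  rw [toPoly_partialFerro N singlet hn, ← toPoly_aklt] at h1
  have he : exponents (embed hn x) = exponents x := rfl
  rw [he, h2] at h1
  exact h1.symm

theorem normSq_sqrtChoose (k b : ℕ) : Complex.normSq (sqrtChoose k b) = k.choose b := by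
  rw [sqrtChoose, Complex.normSq_ofReal, Real.mul_self_sqrt (Nat.cast_nonneg _)]

theorem normSq_partialFerro_embed (hn : 2 ≤ n) (x : Fin N → Fin 3) :
    Complex.normSq (partialFerro n N singlet (embed hn x)) * ∏ i, (n.choose (x i) : ℝ) =
      Complex.normSq (aklt N singlet x) * ∏ i, (Nat.choose 2 (x i) : ℝ) := by
  have := congrArg Complex.normSq (partialFerro_embed hn x)
  simpa only [map_mul, map_prod, normSq_sqrtChoose] using this

theorem choose_rev_mul (n : ℕ) (c : Fin 3) :
    (n.choose c.rev : ℝ) * (n.choose 2 : ℝ) ^ (c : ℕ) = n.choose c * n.choose 2 := by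
  fin_cases c <;> simp [Fin.rev] <;> ring

/-- Reversal multiplies the weight of index c by C(n,2)^(1-c); these exponents sum to zero exactly
when the indices sum to N. -/
theorem prod_choose_rev {x : Fin N → Fin 3} (hn : 2 ≤ n) (hx : ∑ i, (x i : ℕ) = N) :
    ∏ i, (n.choose (x i).rev : ℝ) = ∏ i, (n.choose (x i) : ℝ) := by
  have h0 : (0 : ℝ) < n.choose 2 := by exact_mod_cast Nat.choose_pos hn
  have h := Finset.prod_congr (rfl : (Finset.univ : Finset (Fin N)) = _)
    fun i _ => choose_rev_mul n (x i)
  rw [Finset.prod_mul_distrib, Finset.prod_mul_distrib, Finset.prod_pow_eq_pow_sum, hx,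
    Finset.prod_const, Finset.card_univ, Fintype.card_fin] at h
  exact mul_right_cancel₀ (pow_ne_zero _ h0.ne') h

theorem normSq_partialFerro_rev (hn : 2 ≤ n) (x : Fin N → Fin 3) :
    Complex.normSq (partialFerro n N singlet (embed hn fun i => (x i).rev)) =
      Complex.normSq (partialFerro n N singlet (embed hn x)) := by
  have hpos : ∀ z : Fin N → Fin 3, ∏ i, (n.choose (z i) : ℝ) ≠ 0 := fun z =>
    Finset.prod_ne_zero_iff.2 fun i _ => by
      have : 0 < n.choose (z i) := Nat.choose_pos (by have := (z i).2; omega)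
      exact_mod_cast this.ne'
  have h1 := normSq_partialFerro_embed hn x
  have h2 := normSq_partialFerro_embed hn fun i => (x i).rev
  have ha : Complex.normSq (aklt N singlet fun i => (x i).rev) =
      Complex.normSq (aklt N singlet x) := by
    rw [aklt_rev, map_mul, map_pow, Complex.normSq_neg, map_one, one_pow, one_mul]
  rw [ha] at h2
  -- The sum rule holds only on the support of the AKLT state; off it both amplitudes vanish.
  by_cases h0 : aklt N singlet x = 0
  · rw [h0, map_zero, zero_mul] at h1 h2
    rw [(mul_eq_zero.1 h1).resolve_right (hpos _), (mul_eq_zero.1 h2).resolve_right (hpos _)]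
  · have hx := sum_eq_of_aklt_ne_zero N h0
    have hc : ∀ c : Fin 3, (Nat.choose 2 c.rev : ℝ) = Nat.choose 2 c := by
      intro c; fin_cases c <;> simp [Fin.rev]
    rw [prod_choose_rev hn hx] at h2
    simp only [hc] at h2
    exact mul_right_cancel₀ (hpos x) (h2.trans h1.symm)

theorem partialFerro_eq_zero (hn : 2 ≤ n) {x : Fin N → Fin (n + 1)}
    (hx : x ∉ Set.range (embed (N := N) hn)) : partialFerro n N singlet x = 0 := by
  by_contra hne
  refine hx ⟨fun i => ⟨x i, ?_⟩, rfl⟩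
  exact Nat.lt_succ_iff.2 (degreeOf_toPoly_le_iff.1 (degreeOf_toPoly_partialFerro_le hn i) x hne)

theorem sum_normSq_mul (hn : 2 ≤ n) (g : (Fin N → Fin (n + 1)) → ℝ) :
    ∑ x, Complex.normSq (partialFerro n N singlet x) * g x =
      ∑ x : Fin N → Fin 3, Complex.normSq (partialFerro n N singlet (embed hn x)) *
        g (embed hn x) := by
  symm
  refine Fintype.sum_of_injective (embed hn) ?_ _ _ ?_ fun _ => rfl
  · intro x y h
    funext i
    exact Fin.castLE_injective _ (congrFun h i)
  · intro x hx
    rw [partialFerro_eq_zero hn hx, map_zero, zero_mul]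

/-- The mean of the index of the state at a site is `1`. -/
theorem sum_normSq_partialFerro_mul (hn : 2 ≤ n) (i : Fin N) :
    ∑ x, Complex.normSq (partialFerro n N singlet x) * (1 - (x i : ℕ) : ℝ) = 0 := by
  rw [sum_normSq_mul hn]
  set S := ∑ x : Fin N → Fin 3, Complex.normSq (partialFerro n N singlet (embed hn x)) *
    (1 - ((embed hn x i : ℕ) : ℝ)) with hS
  -- Reversal preserves the weights and sends an index c to 2 - c, hence changes the sign of 1 - c.
  have h : S = -S := by
    rw [hS, ← Finset.sum_neg_distrib]
    refine Fintype.sum_equiv (Equiv.piCongrRight fun _ => Fin.revPerm) _ _ fun x => ?_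
    have hr : Equiv.piCongrRight (fun _ : Fin N => (Fin.revPerm : Equiv.Perm (Fin 3))) x =
      fun i => (x i).rev := rfl
    rw [hr, normSq_partialFerro_rev]
    have : ((embed hn (fun i => (x i).rev) i : ℕ) : ℝ) = 2 - (embed hn x i : ℕ) := by
      simp only [embed, Fin.val_castLE]
      generalize x i = c
      fin_cases c <;> simp [Fin.rev] <;> norm_num
    rw [this]; ring
  linarith

theorem siteOp_spinZ_apply (k : ℕ) {ι : Type} [Fintype ι] [DecidableEq ι] (i : ι)
    (ψ : SpinSpace k ι) (x : ι → Fin (k + 1)) :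
    Matrix.toEuclideanLin (siteOp (spinZ k) i) ψ x = ((k : ℂ) / 2 - (x i : ℕ)) * ψ x := by
  simp only [Matrix.toLpLin_apply, Matrix.mulVec, dotProduct]
  rw [Finset.sum_eq_single x]
  · simp [siteOp, spinZ]
  · intro y _ hy
    rw [siteOp, Matrix.of_apply]
    split_ifs with h
    · have : x i ≠ y i := fun hi => hy (funext fun j => by
        by_cases hj : j = i
        · rw [hj, hi]
        · exact (h j hj).symm)
      rw [spinZ, Matrix.diagonal_apply_ne _ this, zero_mul]
    · rw [zero_mul]
  · simp

theorem expectation_spinZ_partialFerro (hn : 2 ≤ n) (hN : 2 ≤ N) (i : Fin N) :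
    expectation (siteOp (spinZ n) i) (partialFerro n N singlet) = (n : ℂ) / 2 - 1 := by
  have h0 := partialFerro_ne_zero hn hN singlet_ne_zero
  rw [expectation, div_eq_iff (inner_self_ne_zero.2 h0)]
  have h := congrArg (fun r : ℝ => (r : ℂ)) (sum_normSq_partialFerro_mul hn i)
  simp only [Complex.ofReal_sum, Complex.ofReal_mul, Complex.normSq_eq_conj_mul_self,
    Complex.ofReal_zero, Complex.ofReal_sub, Complex.ofReal_one, Complex.ofReal_natCast] at h
  rw [← sub_eq_zero]
  simp only [PiLp.inner_apply, RCLike.inner_apply, siteOp_spinZ_apply, Finset.mul_sum]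
  rw [← Finset.sum_sub_distrib, ← h]
  exact Finset.sum_congr rfl fun x _ => by ring

end Magnetization
end PartialFM

open PartialFM in
theorem mainTheorem3 (n : ℕ) (hn : 5 ≤ n) (N : ℕ) [NeZero N] (hN : 2 ≤ N)
    (J : ℕ → ℝ) (hJ : ∀ T ∈ setK n, 0 < J T) :
    -- closed ring: zero-energy ground state with magnetization `S - 1` on every site
    IsZeroEnergyGroundState (hamiltonian n N J (ringBonds N)) (partialFerro n N singlet) ∧
    (∀ i : Fin N,
      expectation (siteOp (spinZ n) i) (partialFerro n N singlet) = (n : ℂ) / 2 - 1) ∧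
    -- every two-site reduced state lies in `(0 ⊕ 1) ⊗ (2S - 2)`
    (∀ i : Fin N,
      LinearMap.range (Matrix.toEuclideanLin
        (reducedDensity (partialFerro n N singlet) ![i, i + 1])) ≤ pairSpace n) ∧
    -- which consists of total spins `2S - 3`, `2S - 2`, `2S - 1`, none of them in `K`
    pairSpace n ≤ ⨆ T ∈ ({n - 3, n - 2, n - 1} : Finset ℕ),
      spinSector n (Finset.univ : Finset (Fin 2)) (T : ℝ) ∧
    Disjoint ({n - 3, n - 2, n - 1} : Finset ℕ) (setK n) ∧
    -- open chain: the same for every nonzero state of the two edge spins 1/2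
    (∀ E : Matrix (Fin 2) (Fin 2) ℂ, E ≠ 0 →
      IsZeroEnergyGroundState (hamiltonian n N J (openBonds N)) (partialFerro n N E) ∧
      ∀ i ∈ openBonds N,
        LinearMap.range (Matrix.toEuclideanLin
          (reducedDensity (partialFerro n N E) ![i, i + 1])) ≤ pairSpace n) := by
  -- The edge state E sits only on the wrap-around bond, which the open chain omits.
  have hb : ∀ E, ∀ i ∈ openBonds N, bondState N E i = singlet := fun E i hi =>
    if_pos (Finset.mem_filter.1 hi).2
  refine ⟨isZeroEnergyGroundState_partialFerro hn hN hJ singlet_ne_zero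
      fun i _ => bondState_singlet N i,
    fun i => expectation_spinZ_partialFerro (by omega) hN i,
    fun i => range_reducedDensity_partialFerro_le hn hN (bondState_singlet N i),
    pairSpace_le hn, ?_, fun E hE => ⟨isZeroEnergyGroundState_partialFerro hn hN hJ hE (hb E),
      fun i hi => range_reducedDensity_partialFerro_le hn hN (hb E i hi)⟩⟩
  rw [Finset.disjoint_left]
  intro T hT hK
  simp only [setK, Finset.mem_insert, Finset.mem_singleton, Finset.mem_range] at hT hK
  omega
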